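/- Let $g(x,y)=(y^4+2y^3+4y^2+3y+1)x^5-y(y^4-3y^3+4y^2-2y+1)$. An element $a$ of $\overline{\mathbb{Q}}_5$ is called a periodic point of the multi-valued function $\mathfrak{g}(z)$ defined by $g(z,\mathfrak{g}(z))=0$ if there are $n\ge 1$ and $a_1,\dots,a_{n-1}\in\overline{\mathbb{Q}}_5$ with $g(a,a_1)=g(a_1,a_2)=\dots=g(a_{n-1},a)=0$; the least such $n$ is the minimal period of $a$. Let $R^{(1)}(x,x_1)=g(x,x_1)$, $R^{(n)}(x,x_n)=\mathrm{Res}_{x_{n-1}}\bigl(R^{(n-1)}(x,x_{n-1}),g(x_{n-1},x_n)\bigr)$ for $n\ge 2$, $R_n(x)=R^{(n)}(x,x)$, and $\mathsf{P}_n(x)=\prod_{k\mid n}R_k(x)^{\mu(n/k)}$. Let $\mathsf{K}_5\subset\overline{\mathbb{Q}}_5$ be the maximal unramified algebraic extension of $\mathbb{Q}_5$. Theorem 2.1. All the periodic points of $\mathfrak{g}(z)$ in $\overline{\mathbb{Q}}_5$ lie in $\mathsf{K}_5(\sqrt5)$. For every $n\ge 1$, $\mathsf{P}_n(x)$ is a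 polynomial with integer coefficients and with distinct roots, of degree $2\sum_{k\mid n}\mu(n/k)5^k$ if $n>1$ and of degree $9$ if $n=1$; its roots in $\overline{\mathbb{Q}}_5$ are exactly the periodic points of $\mathfrak{g}(z)$ of minimal period $n$, and each of these has degree $n$ over $\mathbb{Q}_5(\sqrt5)$. For $n>1$, exactly half of the periodic points of minimal period $n$ lie in $\mathsf{K}_5$. -/

import Mathlib

open Polynomial

instance factPrimeFive : Fact (Nat.Prime 5) := ⟨Nat.prime_five⟩

/-- The polynomial `g(x, y) = (y⁴ + 2y³ + 4y² + 3y + 1) x⁵ - y (y⁴ - 3y³ + 4y² - 2y + 1)`,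
as an expression in two elements of a commutative ring. -/
def gPoly {A : Type*} [CommRing A] (x y : A) : A :=
  (y ^ 4 + 2 * y ^ 3 + 4 * y ^ 2 + 3 * y + 1) * x ^ 5
    - y * (y ^ 4 - 3 * y ^ 3 + 4 * y ^ 2 - 2 * y + 1)

/-- `a` satisfies `g(a, a₁) = g(a₁, a₂) = ⋯ = g(aₙ₋₁, a) = 0` for some `a₁, …, aₙ₋₁` in `L`
(meaningful for `n ≥ 1`). -/
def HasPeriod (L : Type*) [CommRing L] (n : ℕ) (a : L) : Prop :=
  ∃ c : ℕ → L, c 0 = a ∧ c n = a ∧ ∀ i < n, gPoly (c i) (c (i + 1)) = 0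

/-- `a` is a periodic point, in `L`, of the multi-valued function defined by `g(z, 𝔤(z)) = 0`. -/
def IsPeriodicPoint (L : Type*) [CommRing L] (a : L) : Prop :=
  ∃ n : ℕ, 1 ≤ n ∧ HasPeriod L n a

/-- `n` is the least positive integer that is a period of `a`. -/
def HasMinimalPeriod (L : Type*) [CommRing L] (n : ℕ) (a : L) : Prop :=
  IsLeast {m : ℕ | 1 ≤ m ∧ HasPeriod L m a} n

/-- The iterated resultant `R⁽ⁿ⁾(x, xₙ)`, `n ≥ 1`, an element of `ℤ[x][xₙ]`
(the outer variable is `xₙ`):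
`R⁽¹⁾(x, x₁) = g(x, x₁)` and `R⁽ⁿ⁾(x, xₙ) = Res_{xₙ₋₁}(R⁽ⁿ⁻¹⁾(x, xₙ₋₁), g(xₙ₋₁, xₙ))`.
For the resultant both arguments are viewed in `ℤ[x][xₙ][xₙ₋₁]`; there `X` is `xₙ₋₁`
and `C X` is `xₙ`. The value at `n = 0` is a placeholder. -/
noncomputable def iterRes : ℕ → ℤ[X][X]
  | 0 => 0
  | 1 => gPoly (C X) X
  | n + 2 => resultant ((iterRes (n + 1)).map (C : ℤ[X] →+* ℤ[X][X])) (gPoly X (C X))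

/-- `Rₙ(x) = R⁽ⁿ⁾(x, x)`. -/
noncomputable def Rdiag (n : ℕ) : ℤ[X] := (iterRes n).eval X

/-- `Pₙ(x) = ∏_{k ∣ n} Rₖ(x)^{μ(n/k)}`, an element of the field of fractions of `ℤ[x]`. -/
noncomputable def Pfrac (n : ℕ) : FractionRing ℤ[X] :=
  ∏ k ∈ n.divisors,
    (algebraMap ℤ[X] (FractionRing ℤ[X]) (Rdiag k)) ^ (ArithmeticFunction.moebius (n / k))

/-- A finite extension `E / ℚ₅` inside `ℚ̄₅` is unramified if its ring of integers
(the integral closure of `ℤ₅` in `E`) is unramified over `ℤ₅`. -/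
def IsUnramifiedExt (E : IntermediateField ℚ_[5] (PadicAlgCl 5)) : Prop :=
  FiniteDimensional ℚ_[5] E ∧ Algebra.Unramified ℤ_[5] (integralClosure ℤ_[5] E)

/-- `K₅`, the maximal unramified algebraic extension of `ℚ₅` in `ℚ̄₅`:
the compositum of all finite unramified extensions of `ℚ₅`. -/
noncomputable def maxUnramified : IntermediateField ℚ_[5] (PadicAlgCl 5) :=
  sSup {E | IsUnramifiedExt E}

/-!
Write `s = √5`. All periodic points are integral, and the argument rests on two properties of `g`.
Modulo `5`, `g(x, y) = (y - 2)⁴ (x⁵ - y)`, so that away from the residue class of `2` the relation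
`g(x, y) = 0` lifts `y = x⁵` (`lt_or_lt_of_gPoly`). And the Fricke involution
`A(x) = (-(1 + s) x + 2) / (2 x + 1 + s)` turns the relation around: away from the pole of `A`,
`g(x, y) = 0` if and only if `g(A(y), A(x)) = 0` (`gPoly_fricke`).

*The periodic points.* A cycle of `g` either avoids the class of `2`, and then its reduction is a
Frobenius orbit, or lies in that class. Each residue class `α ≠ 2` with `α^(5ⁿ) = α` contains
exactly one point of period `n` (`exists_hasPeriod_near`, `HasPeriod.eq_of_res_eq`), since it is a
simple root of the reduction `± (x - 2)^(5ⁿ - 1) (x - x^(5ⁿ))` of `Rₙ`. The points in the class of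
`2` are the pole of `A`, which is a fixed point, and the images under `A` of the points outside this
class: all the points of a cycle in this class are closer to `2` than `5^(-1/4)`, since at greater
distances the relation is expanding backwards (`norm_sub_two_lt_of_gPoly`), and for such cycles the
involution `A` leads out of the class (`HasPeriod.one_le_norm_fricke_sub_two`). So there are
`2 (5ⁿ - 1) + 1` points of period `n`. This is the degree of `Rₙ`, whose roots are therefore simple
(`nodup_aroots_Rdiag`). Since `Rₙ = ± x + ⋯` is primitive, the quotients `Pₙ` exist over `ℤ`, and
their roots are the points of minimal period `n` (`dynatomic_spec`).

*Degrees.* Let `a` be periodic outside the class of `2`, with minimal period `n`. Its residue class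
has minimal period `n` under Frobenius, that is, degree `n` over `𝔽₅`, which is the residue field of
both `ℚ₅` and `ℚ₅(s)`. So `a` has degree at least `n` over `ℚ₅(s)`; its conjugates over `ℚ₅` are
periodic with residue classes in one Frobenius orbit, so there are at most `n` of them
(`minpoly_eq_and_natDegree`). The pole of `A` lies in `ℚ₅(s)`, and the remaining periodic points
generate the same fields over `ℚ₅(s)` as their images under `A`.

*Ramification.* For such `a` the integers of `ℚ₅(a)` are `ℤ₅[a]`, and `Rₙ'(a)` is a unit, so
`ℚ₅(a)` is unramified (`isUnramifiedExt_adjoin`). Conversely these fields generate all of `K₅`, since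
an automorphism that fixes them acts trivially on residues, hence on all unramified extensions
(`maxUnramified_le_adjoin`). They do not contain `s`: over `ℚ₅` and over `ℚ₅(s)` the conjugates of
`a` are the same, so some automorphism fixes `a` and moves `s`; choosing `a` to generate a large
finite residue field, it fixes any given finite set of such points (`sqrt_notMem_maxUnramified`).
Finally `a` and `A(a)` cannot both lie in `K₅` unless `a² = -1`, because the equation between them
can be solved for `s`; so for `n > 1` exactly the points outside the class of `2`, one half of all,
lie in `K₅`.
-/

/-! ### The Fricke involution -/

/-- The involution `x ↦ (-(1 + s) x + 2) / (2 x + 1 + s)`, where `s² = 5`; its value at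
the pole is `0`, by division by zero. -/
def fricke {A : Type*} [Field A] (s x : A) : A := (-(1 + s) * x + 2) / (2 * x + 1 + s)

/-- The pole `-(1 + s) / 2` of the Fricke involution. -/
def frickePole {A : Type*} [Field A] (s : A) : A := -(1 + s) / 2

section Fricke

variable {A : Type*} [Field A]

set_option maxRecDepth 20000 in
/-- The Fricke involution turns the relation `g(x, y) = 0` around. -/
theorem gPoly_fricke {s : A} (hs : s ^ 2 = 5) (x y : A) (hx : 2 * x + 1 + s ≠ 0)
    (hy : 2 * y + 1 + s ≠ 0) :
    gPoly (fricke s y) (fricke s x) * (2 * x + 1 + s) ^ 5 * (2 * y + 1 + s) ^ 5 =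
      (10 + 2 * s) ^ 5 * gPoly x y := by
  have key : ∀ Nx Dx Ny Dy : A, Dx ≠ 0 → Dy ≠ 0 →
      gPoly (Ny / Dy) (Nx / Dx) * Dx ^ 5 * Dy ^ 5 =
        (Nx ^ 4 + 2 * Nx ^ 3 * Dx + 4 * Nx ^ 2 * Dx ^ 2 + 3 * Nx * Dx ^ 3 + Dx ^ 4) * Dx * Ny ^ 5
          - Nx * (Nx ^ 4 - 3 * Nx ^ 3 * Dx + 4 * Nx ^ 2 * Dx ^ 2 - 2 * Nx * Dx ^ 3 + Dx ^ 4)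
            * Dy ^ 5 := by
    intro Nx Dx Ny Dy h1 h2
    unfold gPoly
    field_simp
  unfold fricke
  rw [key _ _ _ _ hx hy]
  unfold gPoly
  have h3 : s ^ 3 = 5 * s := by linear_combination s * hs
  have h4 : s ^ 4 = 25 := by linear_combination (s ^ 2 + 5) * hs
  have h5 : s ^ 5 = 25 * s := by linear_combination (s ^ 3 + 5 * s) * hs
  have h6 : s ^ 6 = 125 := by linear_combination (s ^ 4 + 5 * s ^ 2 + 25) * hs
  have h7 : s ^ 7 = 125 * s := by linear_combination s * (s ^ 4 + 5 * s ^ 2 + 25) * hs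
  have h8 : s ^ 8 = 625 := by linear_combination (s ^ 4 + 25) * (s ^ 2 + 5) * hs
  have h9 : s ^ 9 = 625 * s := by linear_combination s * (s ^ 4 + 25) * (s ^ 2 + 5) * hs
  have h10 : s ^ 10 = 3125 := by
    linear_combination s ^ 2 * (s ^ 4 + 25) * (s ^ 2 + 5) * hs + 625 * hs
  ring_nf
  simp only [hs, h3, h4, h5, h6, h7, h8, h9, h10]
  ring

variable [CharZero A] {s : A} (hs : s ^ 2 = 5)
include hs

theorem ten_add_ne_zero : 10 + 2 * s ≠ 0 := by
  intro h
  have : (80 : A) = 0 := by linear_combination (10 - 2 * s) * h + 4 * hs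
  norm_num at this

omit hs in
theorem denom_ne_zero_iff (x : A) : 2 * x + 1 + s ≠ 0 ↔ x ≠ frickePole s := by
  unfold frickePole
  rw [not_iff_not, eq_div_iff two_ne_zero]
  constructor <;> intro h <;> linear_combination h

omit hs in
theorem fricke_mul_denom {x : A} (hx : x ≠ frickePole s) :
    fricke s x * (2 * x + 1 + s) = -(1 + s) * x + 2 :=
  div_mul_cancel₀ _ ((denom_ne_zero_iff x).2 hx)

theorem denom_fricke {x : A} (hx : x ≠ frickePole s) :
    (2 * fricke s x + 1 + s) * (2 * x + 1 + s) = 10 + 2 * s := by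
  linear_combination 2 * fricke_mul_denom hx + hs

theorem fricke_ne_pole {x : A} (hx : x ≠ frickePole s) : fricke s x ≠ frickePole s := by
  rw [← denom_ne_zero_iff]
  intro h
  have := denom_fricke hs hx
  rw [h, zero_mul] at this
  exact ten_add_ne_zero hs this.symm

theorem fricke_fricke {x : A} (hx : x ≠ frickePole s) : fricke s (fricke s x) = x := by
  have h2 := (denom_ne_zero_iff (s := s) _).2 (fricke_ne_pole hs hx)
  refine mul_right_cancel₀ h2 ?_
  rw [fricke_mul_denom (fricke_ne_pole hs hx)]
  linear_combination -fricke_mul_denom hx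

omit [CharZero A] in
/-- The pole of the Fricke involution is totally ramified over itself. -/
theorem gPoly_frickePole [NeZero (2 : A)] (y : A) :
    gPoly (frickePole s) y = -(y - frickePole s) ^ 5 := by
  have h2 : (2 : A) ≠ 0 := NeZero.ne _
  have h3 : s ^ 3 = 5 * s := by linear_combination s * hs
  have h4 : s ^ 4 = 25 := by linear_combination (s ^ 2 + 5) * hs
  have h5 : s ^ 5 = 25 * s := by linear_combination (s ^ 3 + 5 * s) * hs
  unfold gPoly frickePole
  field_simp
  ring_nf
  simp only [hs, h3, h4, h5]
  ring

/-- The Fricke involution reverses the cycles that avoid its pole. -/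
theorem HasPeriod.map_fricke_of_forall {n : ℕ} {c : ℕ → A} (h0 : c n = c 0)
    (hc : ∀ i < n, gPoly (c i) (c (i + 1)) = 0) (he : ∀ i ≤ n, c i ≠ frickePole s) :
    HasPeriod A n (fricke s (c 0)) := by
  refine ⟨fun i ↦ fricke s (c (n - i)), by simp [h0], by simp, fun i hi ↦ ?_⟩
  have hx := (denom_ne_zero_iff (s := s) _).2 (he (n - (i + 1)) (by lia))
  have hy := (denom_ne_zero_iff (s := s) _).2 (he (n - i) (by lia))
  have h1 := gPoly_fricke hs _ _ hx hy
  have h2 := hc (n - (i + 1)) (by lia)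
  rw [show n - (i + 1) + 1 = n - i by lia] at h2
  rw [h2, mul_zero] at h1
  simpa [hx, hy] using h1

theorem hasPeriod_frickePole (n : ℕ) : HasPeriod A n (frickePole s) :=
  ⟨fun _ ↦ frickePole s, rfl, rfl, fun _ _ ↦ by simp [gPoly_frickePole hs]⟩

/-- A chain that meets the pole of the Fricke involution stays there. -/
theorem chain_eq_frickePole {n : ℕ} {c : ℕ → A} (hc : ∀ i < n, gPoly (c i) (c (i + 1)) = 0)
    {i : ℕ} (hi : i ≤ n) (he : c i = frickePole s) : c n = frickePole s := by
  induction n, hi using Nat.le_induction with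
  | base => exact he
  | succ m hm ih =>
    have h1 := hc m (by lia)
    rw [ih fun j hj ↦ hc j (by lia), gPoly_frickePole hs] at h1
    simpa [sub_eq_zero] using h1

/-- A periodic point other than the pole is mapped to a periodic point. -/
theorem HasPeriod.map_fricke {n : ℕ} {a : A} (ha : HasPeriod A n a) (he : a ≠ frickePole s) :
    HasPeriod A n (fricke s a) := by
  obtain ⟨c, rfl, h1, hc⟩ := ha
  refine .map_fricke_of_forall hs h1 hc fun i hi hi' ↦ he ?_
  rw [← h1]
  exact chain_eq_frickePole hs hc hi hi'

end Fricke

/-! ### Cycles and the norm -/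

section Norm

variable {L : Type*} [NormedField L] [IsUltrametricDist L]

theorem norm_sub_le_max' (a b : L) : ‖a - b‖ ≤ max ‖a‖ ‖b‖ := by
  simpa [sub_eq_add_neg] using IsUltrametricDist.norm_add_le_max a (-b)

theorem norm_add_lt_of_lt {a b : L} {r : ℝ} (ha : ‖a‖ < r) (hb : ‖b‖ < r) : ‖a + b‖ < r :=
  (IsUltrametricDist.norm_add_le_max a b).trans_lt (max_lt ha hb)

theorem norm_sub_lt_of_lt {a b : L} {r : ℝ} (ha : ‖a‖ < r) (hb : ‖b‖ < r) : ‖a - b‖ < r :=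
  (norm_sub_le_max' a b).trans_lt (max_lt ha hb)

theorem norm_add_le_of_le' {a b : L} {r : ℝ} (ha : ‖a‖ ≤ r) (hb : ‖b‖ ≤ r) : ‖a + b‖ ≤ r :=
  (IsUltrametricDist.norm_add_le_max a b).trans (max_le ha hb)

theorem norm_sub_le_of_le' {a b : L} {r : ℝ} (ha : ‖a‖ ≤ r) (hb : ‖b‖ ≤ r) : ‖a - b‖ ≤ r :=
  (norm_sub_le_max' a b).trans (max_le ha hb)

theorem norm_add_eq_of_lt {a b : L} (h : ‖b‖ < ‖a‖) : ‖a + b‖ = ‖a‖ := by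
  rw [IsUltrametricDist.norm_add_eq_max_of_norm_ne_norm h.ne', max_eq_left h.le]

theorem norm_ofNat_le_one' (m : ℕ) [m.AtLeastTwo] : ‖(ofNat(m) : L)‖ ≤ 1 :=
  IsUltrametricDist.norm_natCast_le_one L m

theorem norm_ofNat_mul_le (m : ℕ) [m.AtLeastTwo] (x : L) : ‖(ofNat(m) : L) * x‖ ≤ ‖x‖ := by
  rw [norm_mul]
  exact mul_le_of_le_one_left (norm_nonneg _) (norm_ofNat_le_one' m)

omit [IsUltrametricDist L] in
/-- `‖m xʲ‖ ≤ ‖x‖ᵏ` for `‖x‖ ≥ 1` and `j ≤ k`. -/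
theorem norm_mul_pow_le {x c : L} (hc : ‖c‖ ≤ 1) (hx : 1 ≤ ‖x‖) {j k : ℕ} (hjk : j ≤ k) :
    ‖c * x ^ j‖ ≤ ‖x‖ ^ k := by
  rw [norm_mul, norm_pow]
  calc _ ≤ 1 * ‖x‖ ^ j := by gcongr
    _ ≤ _ := by rw [one_mul]; exact pow_le_pow_right₀ hx hjk

theorem norm_le_one_of_gPoly {x y : L} (hx : ‖x‖ ≤ 1) (h : gPoly x y = 0) : ‖y‖ ≤ 1 := by
  by_contra! hy
  have e : y ^ 5 = x ^ 5 * y ^ 4 + 2 * x ^ 5 * y ^ 3 + 4 * x ^ 5 * y ^ 2 + 3 * x ^ 5 * y ^ 1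
      + x ^ 5 * y ^ 0 + 3 * y ^ 4 - 4 * y ^ 3 + 2 * y ^ 2 - 1 * y ^ 1 := by
    unfold gPoly at h
    linear_combination -h
  have hx5 : ‖x ^ 5‖ ≤ 1 := by rw [norm_pow]; exact pow_le_one₀ (norm_nonneg _) hx
  have hm (m : ℕ) [m.AtLeastTwo] : ‖(ofNat(m) : L) * x ^ 5‖ ≤ 1 :=
    (norm_ofNat_mul_le m _).trans hx5
  have h1 : ‖y ^ 5‖ ≤ ‖y‖ ^ 4 := by
    rw [e]
    refine norm_sub_le_of_le' (norm_add_le_of_le' (norm_sub_le_of_le' (norm_add_le_of_le'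
      (norm_add_le_of_le' (norm_add_le_of_le' (norm_add_le_of_le' (norm_add_le_of_le' ?_ ?_) ?_) ?_)
        ?_) ?_) ?_) ?_) ?_ <;>
    refine norm_mul_pow_le ?_ hy.le (by norm_num) <;>
    first | exact hx5 | exact hm _ | exact norm_ofNat_le_one' _ | exact norm_one.le
  rw [norm_pow] at h1
  exact absurd h1 (not_le.2 (pow_lt_pow_right₀ hy (by norm_num)))

theorem norm_eq_pow_of_gPoly {x y : L} (hy : 1 < ‖y‖) (h : gPoly x y = 0) :
    ‖y‖ = ‖x‖ ^ 5 := by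
  have hm (m : ℕ) [m.AtLeastTwo] {j : ℕ} (hj : j ≤ 3) : ‖(ofNat(m) : L) * y ^ j‖ ≤ ‖y‖ ^ 3 :=
    norm_mul_pow_le (norm_ofNat_le_one' m) hy.le hj
  have h1' {j : ℕ} (hj : j ≤ 3) : ‖1 * y ^ j‖ ≤ ‖y‖ ^ 3 :=
    norm_mul_pow_le norm_one.le hy.le hj
  have hlt : ‖y‖ ^ 3 < ‖y ^ 4‖ := by
    rw [norm_pow]; exact pow_lt_pow_right₀ hy (by norm_num)
  have hp : ‖y ^ 4 + 2 * y ^ 3 + 4 * y ^ 2 + 3 * y + 1‖ = ‖y‖ ^ 4 := by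
    rw [show y ^ 4 + 2 * y ^ 3 + 4 * y ^ 2 + 3 * y + 1 =
      y ^ 4 + (2 * y ^ 3 + 4 * y ^ 2 + 3 * y ^ 1 + 1 * y ^ 0) by ring, norm_add_eq_of_lt, norm_pow]
    exact (norm_add_le_of_le' (norm_add_le_of_le' (norm_add_le_of_le' (hm 2 (by norm_num))
      (hm 4 (by norm_num))) (hm 3 (by norm_num))) (h1' (by norm_num))).trans_lt hlt
  have hq : ‖y ^ 4 - 3 * y ^ 3 + 4 * y ^ 2 - 2 * y + 1‖ = ‖y‖ ^ 4 := by
    rw [show y ^ 4 - 3 * y ^ 3 + 4 * y ^ 2 - 2 * y + 1 =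
      y ^ 4 + (4 * y ^ 2 - 3 * y ^ 3 - 2 * y ^ 1 + 1 * y ^ 0) by ring, norm_add_eq_of_lt, norm_pow]
    exact (norm_add_le_of_le' (norm_sub_le_of_le' (norm_sub_le_of_le' (hm 4 (by norm_num))
      (hm 3 (by norm_num))) (hm 2 (by norm_num))) (h1' (by norm_num))).trans_lt hlt
  have h2 := congrArg norm (sub_eq_zero.1 h)
  rw [norm_mul, norm_mul, hp, hq, norm_pow] at h2
  have h4 : ‖y‖ ^ 4 ≠ 0 := by positivity
  have : ‖y‖ ^ 4 * ‖y‖ = ‖y‖ ^ 4 * ‖x‖ ^ 5 := by rw [h2]; ring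
  exact mul_left_cancel₀ h4 this

/-- All the points of a cycle are integral. -/
theorem norm_le_one_of_cycle {n : ℕ} (hn : 1 ≤ n) {c : ℕ → L} (h0 : c n = c 0)
    (hc : ∀ i < n, gPoly (c i) (c (i + 1)) = 0) {i : ℕ} (hi : i ≤ n) : ‖c i‖ ≤ 1 := by
  have up {j m : ℕ} (hjm : j ≤ m) (hm : m ≤ n) (hj : ‖c j‖ ≤ 1) : ‖c m‖ ≤ 1 := by
    induction m, hjm using Nat.le_induction with
    | base => exact hj
    | succ m _ ih => exact norm_le_one_of_gPoly (ih (by lia)) (hc m (by lia))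
  suffices h : ‖c 0‖ ≤ 1 from up (Nat.zero_le i) hi h
  by_contra! hlt
  -- along the cycle the norms are raised to the fifth power, hence strictly increase
  have hgt {j : ℕ} (hj : j ≤ n) : 1 < ‖c j‖ := by
    by_contra! hle
    exact absurd (up hj le_rfl hle) (by rw [h0]; exact not_le.2 hlt)
  have hinc {m : ℕ} (hm : m + 1 ≤ n) : ‖c 0‖ < ‖c (m + 1)‖ := by
    induction m with
    | zero =>
      rw [norm_eq_pow_of_gPoly (hgt hm) (hc 0 hm)]
      exact lt_self_pow₀ hlt (by norm_num)
    | succ m ih =>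
      rw [norm_eq_pow_of_gPoly (hgt hm) (hc _ hm)]
      exact (ih (by lia)).trans (lt_self_pow₀ (hgt (by lia)) (by norm_num))
  have := hinc (m := n - 1) (by lia)
  rw [Nat.sub_add_cancel hn, h0] at this
  exact lt_irrefl _ this

variable (h5 : ‖(5 : L)‖ = 1 / 5)
include h5

omit [IsUltrametricDist L] in
theorem norm_five_mul_lt {z : L} (hz : ‖z‖ ≤ 1) : ‖5 * z‖ < 1 := by
  rw [norm_mul, h5]
  linarith

omit h5 in
theorem norm_pow_sub_pow_lt {x y : L} (hx : ‖x‖ ≤ 1) (hy : ‖y‖ ≤ 1) (h : ‖x - y‖ < 1) (m : ℕ) :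
    ‖x ^ m - y ^ m‖ < 1 := by
  induction m with
  | zero => simp
  | succ m ih =>
    rw [show x ^ (m + 1) - y ^ (m + 1) = (x ^ m - y ^ m) * x + y ^ m * (x - y) by ring]
    refine norm_add_lt_of_lt ?_ ?_
    · rw [norm_mul]; exact (mul_le_of_le_one_right (norm_nonneg _) hx).trans_lt ih
    · rw [norm_mul, norm_pow]
      exact (mul_le_of_le_one_left (norm_nonneg _) (pow_le_one₀ (norm_nonneg _) hy)).trans_lt h

/-- Modulo the maximal ideal, `g(x, y) = (y - 2)⁴ (x⁵ - y)`. -/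
theorem lt_or_lt_of_gPoly {x y : L} (hx : ‖x‖ ≤ 1) (hy : ‖y‖ ≤ 1) (h : gPoly x y = 0) :
    ‖y - 2‖ < 1 ∨ ‖y - x ^ 5‖ < 1 := by
  have e : (y - 2) ^ 4 * (y - x ^ 5) = 5 * ((2 * y ^ 3 - 4 * y ^ 2 + 7 * y - 3) * x ^ 5
      - y * (y ^ 3 - 4 * y ^ 2 + 6 * y - 3)) := by
    unfold gPoly at h
    linear_combination -h
  have hpow {z : L} (hz : ‖z‖ ≤ 1) (m : ℕ) : ‖z ^ m‖ ≤ 1 := by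
    rw [norm_pow]; exact pow_le_one₀ (norm_nonneg _) hz
  have hmul {z w : L} (hz : ‖z‖ ≤ 1) (hw : ‖w‖ ≤ 1) : ‖z * w‖ ≤ 1 := by
    rw [norm_mul]; exact mul_le_one₀ hz (norm_nonneg _) hw
  have hm (m : ℕ) [m.AtLeastTwo] {z : L} (hz : ‖z‖ ≤ 1) : ‖(ofNat(m) : L) * z‖ ≤ 1 :=
    (norm_ofNat_mul_le m _).trans hz
  have h1 : ‖(y - 2) ^ 4 * (y - x ^ 5)‖ < 1 := by
    rw [e]
    refine norm_five_mul_lt h5 (norm_sub_le_of_le' (hmul ?_ (hpow hx _)) (hmul hy ?_))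
    · exact norm_sub_le_of_le' (norm_add_le_of_le' (norm_sub_le_of_le' (hm 2 (hpow hy _))
        (hm 4 (hpow hy _))) (hm 7 hy)) (norm_ofNat_le_one' 3)
    · exact norm_sub_le_of_le' (norm_add_le_of_le' (norm_sub_le_of_le' (hpow hy _)
        (hm 4 (hpow hy _))) (hm 6 hy)) (norm_ofNat_le_one' 3)
  by_contra! hcon
  rw [norm_mul, norm_pow] at h1
  exact absurd h1 (not_lt.2 (one_le_mul_of_one_le_of_one_le (one_le_pow₀ hcon.1) hcon.2))

theorem near_two_of_gPoly {x y : L} (hx : ‖x‖ ≤ 1) (hx2 : ‖x - 2‖ < 1) (h : gPoly x y = 0) :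
    ‖y - 2‖ < 1 := by
  refine (lt_or_lt_of_gPoly h5 hx (norm_le_one_of_gPoly hx h) h).elim id fun h' ↦ ?_
  have h1 := norm_pow_sub_pow_lt hx (norm_ofNat_le_one' 2) hx2 5
  have h2 : ‖(5 : L) * 6‖ < 1 := norm_five_mul_lt h5 (norm_ofNat_le_one' 6)
  rw [show y - 2 = (y - x ^ 5) + (x ^ 5 - 2 ^ 5) + 5 * 6 by ring]
  exact norm_add_lt_of_lt (norm_add_lt_of_lt h' h1) h2

theorem near_two_of_cycle {n : ℕ} (hn : 1 ≤ n) {c : ℕ → L} (h0 : c n = c 0)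
    (hc : ∀ i < n, gPoly (c i) (c (i + 1)) = 0) {i j : ℕ} (hi : i ≤ n) (hj : j ≤ n)
    (h : ‖c i - 2‖ < 1) : ‖c j - 2‖ < 1 := by
  have up {j m : ℕ} (hjm : j ≤ m) (hm : m ≤ n) (hj : ‖c j - 2‖ < 1) : ‖c m - 2‖ < 1 := by
    induction m, hjm using Nat.le_induction with
    | base => exact hj
    | succ m _ ih =>
      exact near_two_of_gPoly h5 (norm_le_one_of_cycle hn h0 hc (by lia)) (ih (by lia))
        (hc m (by lia))
  exact up (Nat.zero_le j) hj (h0 ▸ up hi le_rfl h)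

/-- A cycle away from `2` is an orbit of Frobenius, modulo the maximal ideal. -/
theorem HasPeriod.norm_pow_sub_lt {n : ℕ} (hn : 1 ≤ n) {a : L} (ha : HasPeriod L n a)
    (ha2 : 1 ≤ ‖a - 2‖) : ‖a ^ 5 ^ n - a‖ < 1 := by
  obtain ⟨c, rfl, h0, hc⟩ := ha
  have hint {i : ℕ} (hi : i ≤ n) := norm_le_one_of_cycle hn h0 hc hi
  suffices h : ∀ m ≤ n, ‖c 0 ^ 5 ^ m - c m‖ < 1 by simpa [h0] using h n le_rfl
  intro m hm
  induction m with
  | zero => simp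
  | succ m ih =>
    have h1 := norm_pow_sub_pow_lt (by
      rw [norm_pow]; exact pow_le_one₀ (norm_nonneg _) (hint (Nat.zero_le n)))
      (hint (by lia)) (ih (by lia)) 5
    rcases lt_or_lt_of_gPoly h5 (hint (i := m) (by lia)) (hint hm) (hc m (by lia)) with h2 | h2
    · exact absurd (near_two_of_cycle h5 hn h0 hc hm (Nat.zero_le n) h2) (not_lt.2 ha2)
    · rw [show c 0 ^ 5 ^ (m + 1) - c (m + 1) =
        ((c 0 ^ 5 ^ m) ^ 5 - c m ^ 5) - (c (m + 1) - c m ^ 5) by ring]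
      exact norm_sub_lt_of_lt h1 h2

omit h5 in
theorem HasPeriod.norm_le_one {n : ℕ} (hn : 1 ≤ n) {a : L} (ha : HasPeriod L n a) : ‖a‖ ≤ 1 := by
  obtain ⟨c, rfl, h0, hc⟩ := ha
  exact norm_le_one_of_cycle hn h0 hc (Nat.zero_le n)

/-- In the annulus `5^(-1/4) ≤ |y - 2| < 1` the distance to `2` strictly increases when one goes
backwards. -/
theorem norm_sub_two_lt_of_gPoly {x y : L} (h : gPoly x y = 0) (hy : ‖y - 2‖ < 1)
    (hy4 : 1 / 5 ≤ ‖y - 2‖ ^ 4) : ‖y - 2‖ < ‖x - 2‖ := by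
  by_contra! hle
  obtain ⟨t, rfl⟩ : ∃ t, x = 2 + t := ⟨x - 2, by ring⟩
  obtain ⟨u, rfl⟩ : ∃ u, y = 2 + u := ⟨y - 2, by ring⟩
  simp only [add_sub_cancel_left] at hy hy4 hle
  set r := ‖u‖ with hr
  have hr0 : 0 < r := by
    by_contra! h0
    have : r = 0 := le_antisymm h0 (norm_nonneg u)
    norm_num [this] at hy4
  have ht1 : ‖t‖ ≤ 1 := hle.trans hy.le
  have hm (m : ℕ) [m.AtLeastTwo] (z : L) : ‖5 * ((ofNat(m) : L) * z)‖ ≤ r ^ 4 * ‖z‖ := by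
    rw [norm_mul, h5]
    exact mul_le_mul hy4 (norm_ofNat_mul_le m z) (norm_nonneg _) (by positivity)
  have hr41 : r ^ 4 < r := by
    calc r ^ 4 < r ^ 1 := pow_lt_pow_right_of_lt_one₀ hr0 hy (by norm_num)
      _ = r := pow_one r
  have hr54 : r ^ 5 < r ^ 4 := pow_lt_pow_right_of_lt_one₀ hr0 hy (by norm_num)
  -- the error terms `E = x⁵ - y + u` and `p = y⁴ + 2y³ + 4y² + 3y + 1`
  have hE : ‖t ^ 5 + 5 * (2 * t ^ 4) + 5 * (8 * t ^ 3) + 5 * (16 * t ^ 2) + 5 * (16 * t)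
      + 5 * (6 * 1)‖ < r := by
    have hz {z : L} (m : ℕ) [m.AtLeastTwo] (hz : ‖z‖ ≤ 1) : ‖5 * ((ofNat(m) : L) * z)‖ < r :=
      ((hm m z).trans (mul_le_of_le_one_right (by positivity) hz)).trans_lt hr41
    have hp (j : ℕ) : ‖t ^ j‖ ≤ 1 := by rw [norm_pow]; exact pow_le_one₀ (norm_nonneg _) ht1
    refine norm_add_lt_of_lt (norm_add_lt_of_lt (norm_add_lt_of_lt (norm_add_lt_of_lt
      (norm_add_lt_of_lt ?_ (hz 2 (hp _))) (hz 8 (hp _))) (hz 16 (hp _))) (hz 16 ht1))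
      (hz 6 norm_one.le)
    rw [norm_pow]
    calc ‖t‖ ^ 5 ≤ r ^ 5 := by gcongr
      _ < r := hr54.trans hr41
  have hp : ‖u ^ 4 + 5 * (2 * u ^ 3) + 5 * (8 * u ^ 2) + 5 * (15 * u) + 5 * (11 * 1)‖
      ≤ r ^ 4 := by
    have hz {z : L} (m : ℕ) [m.AtLeastTwo] (hz : ‖z‖ ≤ 1) : ‖5 * ((ofNat(m) : L) * z)‖ ≤ r ^ 4 :=
      (hm m z).trans (mul_le_of_le_one_right (by positivity) hz)
    have hp (j : ℕ) : ‖u ^ j‖ ≤ 1 := by rw [norm_pow]; exact pow_le_one₀ (norm_nonneg _) hy.le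
    refine norm_add_le_of_le' (norm_add_le_of_le' (norm_add_le_of_le'
      (norm_add_le_of_le' ?_ (hz 2 (hp _))) (hz 8 (hp _))) (hz 15 hy.le)) (hz 11 norm_one.le)
    rw [norm_pow]
  have e : u ^ 5 = (t ^ 5 + 5 * (2 * t ^ 4) + 5 * (8 * t ^ 3) + 5 * (16 * t ^ 2) + 5 * (16 * t)
      + 5 * (6 * 1)) * (u ^ 4 + 5 * (2 * u ^ 3) + 5 * (8 * u ^ 2) + 5 * (15 * u) + 5 * (11 * 1))
      - 5 * (2 * u ^ 4) - 5 * (8 * u ^ 3) - 5 * (15 * u ^ 2) + 5 * (5 * u)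
      + 5 * (20 * 1) + 5 * (20 * u) + 5 * (25 * u ^ 2) + 5 * (8 * u ^ 3) + 5 * u ^ 4 := by
    unfold gPoly at h
    linear_combination -h
  have hz2 {z : L} (m : ℕ) [m.AtLeastTwo] (hz : ‖z‖ ≤ r ^ 2) :
      ‖5 * ((ofNat(m) : L) * z)‖ < r ^ 5 := by
    refine (hm m z).trans_lt ?_
    calc r ^ 4 * ‖z‖ ≤ r ^ 4 * r ^ 2 := by gcongr
      _ = r ^ 5 * r := by ring
      _ < r ^ 5 * 1 := by gcongr
      _ = r ^ 5 := mul_one _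
  have hup {j : ℕ} (hj : 2 ≤ j) : ‖u ^ j‖ ≤ r ^ 2 := by
    rw [norm_pow]; exact pow_le_pow_of_le_one hr0.le hy.le hj
  have h25 {z : L} (hz : ‖z‖ ≤ 1) : ‖5 * (5 * z)‖ < r ^ 5 := by
    rw [norm_mul, norm_mul, h5]
    calc 1 / 5 * (1 / 5 * ‖z‖) ≤ r ^ 4 * (r ^ 4 * 1) := by gcongr
      _ = r ^ 5 * r ^ 3 := by ring
      _ < r ^ 5 * 1 := by gcongr; exact pow_lt_one₀ hr0.le hy (by norm_num)
      _ = r ^ 5 := mul_one _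
  have : ‖u ^ 5‖ < r ^ 5 := by
    rw [e]
    refine norm_add_lt_of_lt (norm_add_lt_of_lt (norm_add_lt_of_lt (norm_add_lt_of_lt
      (norm_add_lt_of_lt (norm_add_lt_of_lt (norm_sub_lt_of_lt (norm_sub_lt_of_lt
      (norm_sub_lt_of_lt ?_ ?_) ?_) ?_) ?_) ?_) ?_) ?_) ?_) ?_
    · rw [norm_mul]
      calc _ ≤ _ * r ^ 4 := by gcongr
        _ < r * r ^ 4 := by gcongr
        _ = r ^ 5 := by ring
    · exact hz2 2 (hup (by norm_num))
    · exact hz2 8 (hup (by norm_num))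
    · exact hz2 15 (hup (by norm_num))
    · exact h25 hy.le
    · rw [show (20 : L) * 1 = 5 * 4 by norm_num]; exact h25 (norm_ofNat_le_one' 4)
    · rw [show (20 : L) * u = 5 * (4 * u) by ring]
      exact h25 ((norm_ofNat_mul_le 4 u).trans hy.le)
    · exact hz2 25 (hup (by norm_num))
    · exact hz2 8 (hup (by norm_num))
    · have := h25 (z := u ^ 4) (by rw [norm_pow]; exact pow_le_one₀ (norm_nonneg _) hy.le)
      rw [norm_mul, h5]
      calc 1 / 5 * ‖u ^ 4‖ ≤ r ^ 4 * r ^ 2 := by gcongr; exact hup (by norm_num)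
        _ = r ^ 5 * r := by ring
        _ < r ^ 5 * 1 := by gcongr
        _ = r ^ 5 := mul_one _
  rw [norm_pow] at this
  exact lt_irrefl _ this

theorem HasPeriod.norm_sub_two_pow_lt {n : ℕ} (hn : 1 ≤ n) {a : L} (ha : HasPeriod L n a)
    (ha2 : ‖a - 2‖ < 1) : ‖a - 2‖ ^ 4 < 1 / 5 := by
  obtain ⟨c, rfl, h0, hc⟩ := ha
  by_contra! hcon
  have hnear {i : ℕ} (hi : i ≤ n) := near_two_of_cycle h5 hn h0 hc (Nat.zero_le n) hi ha2
  have hdec : ∀ j, j + 1 ≤ n → ‖c n - 2‖ < ‖c (n - (j + 1)) - 2‖ := by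
    intro j
    induction j with
    | zero =>
      intro hj
      have h1 := hc (n - 1) (by lia)
      rw [Nat.sub_add_cancel hn] at h1
      exact norm_sub_two_lt_of_gPoly h5 h1 (hnear le_rfl) (by rwa [h0])
    | succ j ih =>
      intro hj
      have h1 := hc (n - (j + 2)) (by lia)
      rw [show n - (j + 2) + 1 = n - (j + 1) by lia] at h1
      have h2 := ih (by lia)
      refine h2.trans (norm_sub_two_lt_of_gPoly h5 h1 (hnear (by lia)) (hcon.trans ?_))
      rw [← h0]
      gcongr
  have := hdec (n - 1) (by lia)
  rw [show n - (n - 1 + 1) = 0 by lia, h0] at this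
  exact lt_irrefl _ this

variable {s : L} (hs : s ^ 2 = 5)
include hs

omit [IsUltrametricDist L] in
theorem norm_sq_sqrt_five : ‖s‖ ^ 2 = 1 / 5 := by rw [← norm_pow, hs, h5]

omit [IsUltrametricDist L] in
theorem norm_sqrt_five_lt : ‖s‖ < 1 := by
  have := norm_sq_sqrt_five h5 hs
  by_contra! h
  have := one_le_pow₀ (n := 2) h
  linarith

omit h5 [IsUltrametricDist L] in
theorem fricke_sub_two_mul [CharZero L] {x : L} (hx : x ≠ frickePole s) :
    (fricke s x - 2) * (s * (s + 1) + 2 * (x - 2)) = -s * (2 * s + 4 + (s + 1) * (x - 2)) := by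
  linear_combination fricke_mul_denom hx + (fricke s x + x - 2) * hs

omit hs in
theorem norm_two : ‖(2 : L)‖ = 1 := by
  refine le_antisymm (norm_ofNat_le_one' 2) ?_
  by_contra! h
  have h1 : ‖(5 : L) * 1‖ < 1 := norm_five_mul_lt h5 norm_one.le
  have h2 : ‖(2 : L) * 2‖ < 1 := by rw [norm_mul]; nlinarith [norm_nonneg (2 : L)]
  have := norm_sub_lt_of_lt h1 h2
  rw [show (5 : L) * 1 - 2 * 2 = 1 by norm_num, norm_one] at this
  exact lt_irrefl _ this

theorem norm_one_add_sqrt_five : ‖s + 1‖ = 1 := by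
  have := norm_add_eq_of_lt (a := (1 : L)) (b := s)
    (by rw [norm_one]; exact norm_sqrt_five_lt h5 hs)
  rwa [add_comm, norm_one] at this

/-- The Fricke involution maps what is not congruent to `2` into the residue class of `2`. -/
theorem norm_fricke_sub_two_lt [CharZero L] {x : L} (hx : x ≠ frickePole s) (h1 : ‖x‖ ≤ 1)
    (h2 : 1 ≤ ‖x - 2‖) : ‖fricke s x - 2‖ < 1 := by
  have h := congrArg norm (fricke_sub_two_mul hs hx)
  have hs1 := norm_sqrt_five_lt h5 hs
  have hs2 := norm_one_add_sqrt_five h5 hs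
  have hx2 : ‖x - 2‖ = 1 := le_antisymm (norm_sub_le_of_le' h1 (norm_ofNat_le_one' 2)) h2
  have hD : ‖s * (s + 1) + 2 * (x - 2)‖ = 1 := by
    rw [add_comm, norm_add_eq_of_lt] <;> rw [norm_mul 2, norm_two h5, hx2, one_mul]
    rwa [norm_mul, hs2, mul_one]
  rw [norm_mul, hD, mul_one, norm_mul, norm_neg] at h
  rw [h]
  refine (mul_le_of_le_one_right (norm_nonneg _) ?_).trans_lt hs1
  refine norm_add_le_of_le' (norm_add_le_of_le' ?_ (norm_ofNat_le_one' 4)) ?_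
  · exact (norm_ofNat_mul_le 2 s).trans hs1.le
  · rw [norm_mul, hs2, hx2, one_mul]

theorem frickePole_norm_sub_two_lt [CharZero L] : ‖frickePole s - 2‖ < 1 := by
  have h2 := norm_two h5
  have h : ‖2 * (frickePole s - 2)‖ < 1 := by
    rw [show 2 * (frickePole s - 2) = -(s * 1) - 5 * 1 by unfold frickePole; field_simp; ring]
    refine norm_sub_lt_of_lt ?_ (norm_five_mul_lt h5 norm_one.le)
    simpa using norm_sqrt_five_lt h5 hs
  rwa [norm_mul, h2, one_mul] at h

/-- A periodic point congruent to `2`, other than the pole, is the image of a periodic point that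
is not congruent to `2`. -/
theorem HasPeriod.one_le_norm_fricke_sub_two [CharZero L] {n : ℕ} (hn : 1 ≤ n) {a : L}
    (ha : HasPeriod L n a) (ha2 : ‖a - 2‖ < 1) (he : a ≠ frickePole s) :
    1 ≤ ‖fricke s a - 2‖ := by
  by_contra! hcon
  have h := congrArg norm (fricke_sub_two_mul hs he)
  have hs1 := norm_sqrt_five_lt h5 hs
  have hs2 := norm_one_add_sqrt_five h5 hs
  have hs5 := norm_sq_sqrt_five h5 hs
  have hs0 : 0 < ‖s‖ := by
    refine norm_pos_iff.2 fun h0 ↦ ?_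
    rw [h0] at hs5; norm_num at hs5
  have h2 := norm_two h5
  have hN : ‖2 * s + 4 + (s + 1) * (a - 2)‖ = 1 := by
    have h4 : ‖(4 : L)‖ = 1 := by rw [show (4 : L) = 2 * 2 by norm_num, norm_mul, h2, one_mul]
    rw [show 2 * s + 4 + (s + 1) * (a - 2) = 4 + (2 * s + (s + 1) * (a - 2)) by ring,
      norm_add_eq_of_lt, h4]
    rw [h4]
    refine norm_add_lt_of_lt ((norm_ofNat_mul_le 2 s).trans_lt hs1) ?_
    rwa [norm_mul, hs2, one_mul]
  rw [norm_mul, norm_mul, norm_neg, hN, mul_one] at h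
  rcases le_or_gt ‖a - 2‖ ‖s‖ with hle | hgt
  · have hD : ‖s * (s + 1) + 2 * (a - 2)‖ ≤ ‖s‖ := by
      refine norm_add_le_of_le' ?_ ((norm_ofNat_mul_le 2 _).trans hle)
      rw [norm_mul, hs2, mul_one]
    have : ‖fricke s a - 2‖ * ‖s * (s + 1) + 2 * (a - 2)‖ < ‖s‖ := by
      calc _ ≤ ‖fricke s a - 2‖ * ‖s‖ := by gcongr
        _ < 1 * ‖s‖ := by gcongr
        _ = ‖s‖ := one_mul _
    exact this.ne h
  · have hD : ‖s * (s + 1) + 2 * (a - 2)‖ = ‖a - 2‖ := by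
      rw [add_comm, norm_add_eq_of_lt] <;> rw [norm_mul 2, h2, one_mul]
      rwa [norm_mul, hs2, mul_one]
    rw [hD] at h
    have h1 := ha.norm_sub_two_pow_lt h5 hn ha2
    have h3 := (ha.map_fricke hs he).norm_sub_two_pow_lt h5 hn hcon
    have h4 : (‖fricke s a - 2‖ * ‖a - 2‖) ^ 4 < 1 / 5 * (1 / 5) := by
      rw [mul_pow]
      exact mul_lt_mul'' h3 h1 (by positivity) (by positivity)
    rw [h, show ‖s‖ ^ 4 = (‖s‖ ^ 2) ^ 2 by ring, hs5] at h4
    norm_num at h4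

end Norm

/-! ### The iterated resultants -/

theorem map_gPoly {A B F : Type*} [CommRing A] [CommRing B] [FunLike F A B] [RingHomClass F A B]
    (φ : F) (x y : A) : φ (gPoly x y) = gPoly (φ x) (φ y) := by
  simp [gPoly, map_ofNat]

section Bivariate

variable {B : Type*} [CommRing B]

theorem gPoly_C_X_eq (ξ : B) : gPoly (C ξ) X =
    -X ^ 5 + (C (ξ ^ 5 + 3) * X ^ 4 + C (2 * ξ ^ 5 - 4) * X ^ 3 + C (4 * ξ ^ 5 + 2) * X ^ 2
      + C (3 * ξ ^ 5 - 1) * X + C (ξ ^ 5)) := by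
  simp only [gPoly, C_add, C_sub, C_mul, C_pow, C_ofNat, C_1]
  ring

theorem gPoly_C_X_degree_lt (ξ : B) : (C (ξ ^ 5 + 3) * X ^ 4 + C (2 * ξ ^ 5 - 4) * X ^ 3
    + C (4 * ξ ^ 5 + 2) * X ^ 2 + C (3 * ξ ^ 5 - 1) * X + C (ξ ^ 5)).natDegree ≤ 4 := by
  compute_degree

theorem gPoly_C_X_natDegree [Nontrivial B] (ξ : B) : (gPoly (C ξ) X).natDegree = 5 := by
  rw [gPoly_C_X_eq, natDegree_add_eq_left_of_natDegree_lt] <;> rw [natDegree_neg, natDegree_X_pow]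
  exact (gPoly_C_X_degree_lt ξ).trans_lt (by norm_num)

theorem gPoly_C_X_leadingCoeff [Nontrivial B] (ξ : B) : (gPoly (C ξ) X).leadingCoeff = -1 := by
  rw [leadingCoeff, gPoly_C_X_natDegree, gPoly_C_X_eq, coeff_add,
    coeff_eq_zero_of_natDegree_lt ((gPoly_C_X_degree_lt ξ).trans_lt (by norm_num))]
  simp

theorem gPoly_X_C_eq (y : B) : gPoly X (C y) =
    C (y ^ 4 + 2 * y ^ 3 + 4 * y ^ 2 + 3 * y + 1) * X ^ 5
      - C (y * (y ^ 4 - 3 * y ^ 3 + 4 * y ^ 2 - 2 * y + 1)) := by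
  simp [gPoly, C_ofNat]

theorem gPoly_X_C_natDegree_le (y : B) : (gPoly X (C y)).natDegree ≤ 5 := by
  rw [gPoly_X_C_eq]
  compute_degree

theorem gPoly_X_C_X_natDegree [Nontrivial B] : (gPoly X (C X) : B[X][X]).natDegree = 5 := by
  refine natDegree_eq_of_le_of_coeff_ne_zero (gPoly_X_C_natDegree_le _) ?_
  rw [gPoly_X_C_eq, coeff_sub, coeff_C_mul, coeff_X_pow, coeff_C]
  intro h
  have := congrArg (eval 0) h
  simp at this

end Bivariate

/-- Base change for the recursion that defines the iterated resultants. -/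
theorem iterRes_succ_map {B : Type*} [CommRing B] (φ : ℤ[X] →+* B) {n : ℕ} (hn : 1 ≤ n) :
    (iterRes (n + 1)).map φ = resultant (((iterRes n).map φ).map (C : B →+* B[X]))
      (gPoly X (C X)) (iterRes n).natDegree 5 := by
  obtain ⟨n, rfl⟩ := Nat.exists_eq_add_of_le' hn
  have h1 : iterRes (n + 1 + 1) = resultant ((iterRes (n + 1)).map (C : ℤ[X] →+* ℤ[X][X]))
      (gPoly X (C X)) (iterRes (n + 1)).natDegree 5 := by
    rw [iterRes, natDegree_map_eq_of_injective C_injective]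
    exact congrArg _ gPoly_X_C_X_natDegree
  rw [h1, ← coe_mapRingHom, ← resultant_map_map, coe_mapRingHom]
  congr 1
  · rw [map_map, map_map]
    congr 1
    ext <;> simp
  · rw [← coe_mapRingHom, map_gPoly]
    simp

/-- If the specialization of `R⁽ⁿ⁾(x, y)` at `x` is `± ∏ (y - ξ)`, then that of `R⁽ⁿ⁺¹⁾(x, y)`
is `± ∏ g(ξ, y)`. -/
theorem iterRes_succ_map_eq_prod {B : Type*} [CommRing B] [IsDomain B] (φ : ℤ[X] →+* B) {n : ℕ}
    (hn : 1 ≤ n) (hlc : (iterRes n).leadingCoeff = (-1) ^ n) {S : Multiset B}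
    (hS : (iterRes n).map φ = C ((-1) ^ n) * (S.map fun ξ ↦ X - C ξ).prod) :
    (iterRes (n + 1)).map φ = C ((-1) ^ n) * (S.map fun ξ ↦ gPoly (C ξ) X).prod := by
  rw [iterRes_succ_map φ hn]
  have hne : ((-1) ^ n : B[X]) ≠ 0 := pow_ne_zero _ (by simp)
  have hmap : ((iterRes n).map φ).map (C : B →+* B[X]) =
      C ((-1) ^ n) * ((S.map C).map fun ξ ↦ X - C ξ).prod := by
    rw [hS, Polynomial.map_mul, map_C, Polynomial.map_multiset_prod, Multiset.map_map,
      Multiset.map_map]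
    simp
  have hdeg : (iterRes n).natDegree = (((iterRes n).map φ).map (C : B →+* B[X])).natDegree := by
    rw [natDegree_map_eq_of_injective C_injective, natDegree_map_of_leadingCoeff_ne_zero]
    rw [hlc]
    simp
  rw [hdeg, resultant_eq_prod_eval _ _ _ (gPoly_X_C_natDegree_le _) ?_]
  · rw [hmap, roots_C_mul _ hne, roots_multiset_prod_X_sub_C, leadingCoeff_mul, leadingCoeff_C,
      Monic.leadingCoeff (monic_multisetProd_X_sub_C _), mul_one, Multiset.map_map]
    congr 1
    · rw [← pow_mul, mul_comm, pow_mul]; norm_num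
    · congr 1
      refine Multiset.map_congr rfl fun ξ _ ↦ ?_
      rw [Function.comp_apply, ← coe_evalRingHom, map_gPoly]
      simp
  · rw [hmap]
    refine Splits.mul (Splits.C _) ?_
    refine Splits.multisetProd fun f hf ↦ ?_
    obtain ⟨ξ, -, rfl⟩ := Multiset.mem_map.1 hf
    exact Splits.X_sub_C ξ

theorem prod_gPoly_natDegree_and_leadingCoeff {B : Type*} [CommRing B] [IsDomain B]
    (S : Multiset B) : ((S.map fun ξ ↦ gPoly (C ξ) X).prod).natDegree = 5 * S.card ∧
      ((S.map fun ξ ↦ gPoly (C ξ) X).prod).leadingCoeff = (-1) ^ S.card := by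
  induction S using Multiset.induction with
  | empty => simp
  | cons a S ih =>
    have h0 : gPoly (C a) X ≠ (0 : B[X]) := fun h ↦ by
      simpa [h] using gPoly_C_X_leadingCoeff a
    have h1 : (S.map fun ξ ↦ gPoly (C ξ) X).prod ≠ (0 : B[X]) := fun h ↦ by
      have := ih.2
      rw [h, leadingCoeff_zero] at this
      exact pow_ne_zero _ (neg_ne_zero.2 one_ne_zero) this.symm
    rw [Multiset.map_cons, Multiset.prod_cons, natDegree_mul h0 h1, leadingCoeff_mul, ih.1, ih.2,
      gPoly_C_X_natDegree, gPoly_C_X_leadingCoeff, Multiset.card_cons]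
    constructor <;> ring

/-- The degree is computed over an algebraic closure of `ℚ(x)`, where `R⁽ⁿ⁾(x, y)` splits. -/
theorem iterRes_natDegree_and_leadingCoeff {n : ℕ} (hn : 1 ≤ n) :
    (iterRes n).natDegree = 5 ^ n ∧ (iterRes n).leadingCoeff = (-1) ^ n := by
  induction n, hn using Nat.le_induction with
  | base => simp [iterRes, gPoly_C_X_natDegree, gPoly_C_X_leadingCoeff]
  | succ n hn ih =>
    let K := AlgebraicClosure (FractionRing ℤ[X])
    let φ : ℤ[X] →+* K := (algebraMap (FractionRing ℤ[X]) K).comp (algebraMap ℤ[X] _)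
    have hφ : Function.Injective φ :=
      (algebraMap (FractionRing ℤ[X]) K).injective.comp (IsFractionRing.injective _ _)
    have hlc : ((iterRes n).map φ).leadingCoeff = (-1) ^ n := by
      rw [leadingCoeff_map_of_injective hφ, ih.2]; simp
    have hS : (iterRes n).map φ =
        C ((-1) ^ n) * (((iterRes n).map φ).roots.map fun ξ ↦ X - C ξ).prod := by
      rw [← hlc]
      exact (IsAlgClosed.splits _).eq_prod_roots
    have hcard : ((iterRes n).map φ).roots.card = 5 ^ n := by
      rw [← (IsAlgClosed.splits _).natDegree_eq_card_roots, natDegree_map_eq_of_injective hφ, ih.1]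
    have h := iterRes_succ_map_eq_prod φ hn ih.2 hS
    obtain ⟨h1, h2⟩ := prod_gPoly_natDegree_and_leadingCoeff ((iterRes n).map φ).roots
    rw [hcard] at h1 h2
    constructor
    · rw [← natDegree_map_eq_of_injective hφ, h, natDegree_C_mul (pow_ne_zero _ (by simp)), h1]
      ring
    · apply hφ
      rw [← leadingCoeff_map_of_injective hφ, h, leadingCoeff_mul, h2, leadingCoeff_C,
        Odd.neg_one_pow (Odd.pow (by decide))]
      simp [pow_succ]

theorem iterRes_natDegree {n : ℕ} (hn : 1 ≤ n) : (iterRes n).natDegree = 5 ^ n :=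
  (iterRes_natDegree_and_leadingCoeff hn).1

theorem iterRes_leadingCoeff {n : ℕ} (hn : 1 ≤ n) : (iterRes n).leadingCoeff = (-1) ^ n :=
  (iterRes_natDegree_and_leadingCoeff hn).2

theorem iterRes_map_leadingCoeff {B : Type*} [CommRing B] [Nontrivial B] (φ : ℤ[X] →+* B) {n : ℕ}
    (hn : 1 ≤ n) : ((iterRes n).map φ).leadingCoeff = (-1) ^ n := by
  have : φ (iterRes n).leadingCoeff ≠ 0 := by
    rw [iterRes_leadingCoeff hn, map_pow, map_neg, map_one]
    exact (IsUnit.pow _ isUnit_neg_one).ne_zero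
  rw [leadingCoeff_map_of_leadingCoeff_ne_zero _ this, iterRes_leadingCoeff hn]
  simp

/-- Over an algebraically closed field, the roots of `R⁽ⁿ⁾(a, y)` are the ends of the chains
that start at `a`. -/
theorem eval_iterRes_map_eq_zero_iff {K : Type*} [Field K] [IsAlgClosed K] (φ : ℤ[X] →+* K)
    {n : ℕ} (hn : 1 ≤ n) (b : K) : ((iterRes n).map φ).eval b = 0 ↔
      ∃ c : ℕ → K, c 0 = φ X ∧ c n = b ∧ ∀ i < n, gPoly (c i) (c (i + 1)) = 0 := by
  induction n, hn using Nat.le_induction generalizing b with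
  | base =>
    have h : ((iterRes 1).map φ).eval b = gPoly (φ X) b := by
      rw [iterRes, ← coe_mapRingHom, map_gPoly, ← coe_evalRingHom, map_gPoly]
      simp
    rw [h]
    constructor
    · intro h0
      refine ⟨fun i ↦ if i = 0 then φ X else b, by simp, by simp, fun i hi ↦ ?_⟩
      obtain rfl : i = 0 := by lia
      simpa using h0
    · rintro ⟨c, h0, rfl, hc⟩
      simpa [h0] using hc 0 one_pos
  | succ n hn ih =>
    have hS : (iterRes n).map φ =
        C ((-1) ^ n) * (((iterRes n).map φ).roots.map fun ξ ↦ X - C ξ).prod := by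
      rw [← iterRes_map_leadingCoeff φ hn]
      exact (IsAlgClosed.splits _).eq_prod_roots
    have hne : (iterRes n).map φ ≠ 0 := fun h ↦ by
      have := iterRes_map_leadingCoeff φ hn
      rw [h, leadingCoeff_zero] at this
      exact pow_ne_zero _ (neg_ne_zero.2 one_ne_zero) this.symm
    rw [iterRes_succ_map_eq_prod φ hn (iterRes_leadingCoeff hn) hS, eval_mul, eval_C,
      mul_eq_zero_iff_left (pow_ne_zero _ (neg_ne_zero.2 one_ne_zero)), eval_multiset_prod,
      Multiset.prod_eq_zero_iff, Multiset.map_map]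
    simp only [Multiset.mem_map, mem_roots hne, IsRoot.def, ih, Function.comp_apply]
    constructor
    · rintro ⟨ξ, ⟨c, h0, rfl, hc⟩, hξ⟩
      refine ⟨fun i ↦ if i ≤ n then c i else b, by simp [h0], by simp, fun i hi ↦ ?_⟩
      rw [← coe_evalRingHom, map_gPoly] at hξ
      rcases Nat.lt_succ_iff_lt_or_eq.1 hi with h | rfl
      · simpa [h.le, Nat.succ_le_of_lt h] using hc i h
      · simpa using hξ
    · rintro ⟨c, h0, rfl, hc⟩
      refine ⟨c n, ⟨c, h0, rfl, fun i hi ↦ hc i (by lia)⟩, ?_⟩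
      rw [← coe_evalRingHom, map_gPoly]
      simpa using hc n (by lia)

theorem map_Rdiag {B : Type*} [CommRing B] (φ : ℤ[X] →+* B) (n : ℕ) :
    φ (Rdiag n) = ((iterRes n).map φ).eval (φ X) := by
  rw [Rdiag, eval_map, eval, hom_eval₂, RingHom.comp_id]

/-- The roots of `Rₙ` are the points of period `n`. -/
theorem aeval_Rdiag_eq_zero_iff {K : Type*} [Field K] [IsAlgClosed K] [Algebra ℤ K]
    {n : ℕ} (hn : 1 ≤ n) (a : K) : aeval a (Rdiag n) = 0 ↔ HasPeriod K n a := by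
  have h := map_Rdiag (aeval a : ℤ[X] →ₐ[ℤ] K).toRingHom n
  have h' := eval_iterRes_map_eq_zero_iff (aeval a : ℤ[X] →ₐ[ℤ] K).toRingHom hn a
  simp only [AlgHom.toRingHom_eq_coe, RingHom.coe_coe, aeval_X] at h h'
  rw [h, h', HasPeriod]

/-! ### Reduction modulo `5`, degree and primitivity of `Rₙ` -/

theorem gPoly_charP_five {B : Type*} [CommRing B] [CharP B 5] (x y : B) :
    gPoly x y = -((y - 2) ^ 4 * (y - x ^ 5)) := by
  have h5 : (5 : B) = 0 := CharP.cast_eq_zero B 5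
  unfold gPoly
  linear_combination ((2 * y ^ 3 - 4 * y ^ 2 + 7 * y - 3) * x ^ 5
      - y * (y ^ 3 - 4 * y ^ 2 + 6 * y - 3)) * h5

theorem iterRes_map_charP_five {B : Type*} [CommRing B] [IsDomain B] [CharP B 5]
    (φ : ℤ[X] →+* B) {n : ℕ} (hn : 1 ≤ n) : (iterRes n).map φ =
      C ((-1) ^ n) * ((X - C 2) ^ (5 ^ n - 1) * (X - C (φ X ^ 5 ^ n))) := by
  have h5 : (5 : B[X]) = 0 := CharP.cast_eq_zero B[X] 5
  induction n, hn using Nat.le_induction with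
  | base =>
    rw [iterRes, ← coe_mapRingHom, map_gPoly, gPoly_charP_five]
    simp [C_ofNat]
  | succ n hn ih =>
    have hS : (iterRes n).map φ = C ((-1) ^ n) * (((Multiset.replicate (5 ^ n - 1) 2) +
        {φ X ^ 5 ^ n}).map fun ξ ↦ X - C ξ).prod := by
      rw [ih]
      simp
    have hpow : 5 ^ (n + 1) - 1 = 5 * (5 ^ n - 1) + 4 := by
      have : 1 ≤ 5 ^ n := Nat.one_le_pow _ _ (by norm_num)
      rw [pow_succ]
      lia
    have hodd : (-1 : B[X]) ^ (5 ^ n - 1) = 1 := by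
      refine Even.neg_one_pow ?_
      exact Nat.Odd.sub_odd (Odd.pow (by decide)) odd_one
    have h2 : gPoly (C 2) X = -(X - C (2 : B)) ^ 5 := by
      rw [gPoly_charP_five]
      simp only [C_ofNat]
      linear_combination 6 * (X - 2) ^ 4 * h5
    rw [iterRes_succ_map_eq_prod φ hn (iterRes_leadingCoeff hn) hS]
    simp only [Multiset.map_add, Multiset.map_replicate, Multiset.map_singleton,
      Multiset.prod_add, Multiset.prod_replicate, Multiset.prod_singleton, h2]
    rw [neg_pow ((X - C 2) ^ 5), hodd, one_mul, gPoly_charP_five, hpow, ← pow_mul]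
    simp only [C_pow, C_neg, C_1, C_ofNat]
    ring

theorem Rdiag_map_charP_five {B : Type*} [CommRing B] [IsDomain B] [CharP B 5]
    {n : ℕ} (hn : 1 ≤ n) : (Rdiag n).map (Int.castRingHom B) =
      C ((-1) ^ n) * ((X - C 2) ^ (5 ^ n - 1) * (X - X ^ 5 ^ n)) := by
  rw [← coe_mapRingHom, map_Rdiag, iterRes_map_charP_five _ hn]
  simp [C_ofNat]

/-- The polynomials in `x, y` (`y` being the outer variable) of degree at most `d` in `x`. -/
def InnerDegreeLE {R : Type*} [CommRing R] (d : ℕ) (f : R[X][X]) : Prop :=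
  ∀ i, (f.coeff i).natDegree ≤ d

namespace InnerDegreeLE

variable {R : Type*} [CommRing R] {d e : ℕ} {f g : R[X][X]}

theorem mul (hf : InnerDegreeLE d f) (hg : InnerDegreeLE e g) : InnerDegreeLE (d + e) (f * g) := by
  intro i
  rw [coeff_mul]
  exact natDegree_sum_le_of_forall_le _ _ fun p _ ↦ natDegree_mul_le_of_le (hf _) (hg _)

theorem sum {ι : Type*} (s : Finset ι) {f : ι → R[X][X]} (h : ∀ i ∈ s, InnerDegreeLE d (f i)) :
    InnerDegreeLE d (∑ i ∈ s, f i) := by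
  intro j
  rw [finsetSum_coeff]
  exact natDegree_sum_le_of_forall_le _ _ fun i hi ↦ h i hi j

theorem one (d : ℕ) : InnerDegreeLE d (1 : R[X][X]) := by
  intro i
  rw [coeff_one]
  split_ifs <;> simp

theorem zero (d : ℕ) : InnerDegreeLE d (0 : R[X][X]) := by
  intro i
  simp

theorem prod {ι : Type*} (s : Finset ι) {f : ι → R[X][X]} {d : ι → ℕ}
    (h : ∀ i ∈ s, InnerDegreeLE (d i) (f i)) : InnerDegreeLE (∑ i ∈ s, d i) (∏ i ∈ s, f i) := by
  classical
  induction s using Finset.induction with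
  | empty => simpa using one 0
  | insert a s ha ih =>
    rw [Finset.sum_insert ha, Finset.prod_insert ha]
    exact (h a (by simp)).mul (ih fun i hi ↦ h i (by simp [hi]))

/-- Expanding a determinant, the degrees of the columns add up. -/
theorem det {m : ℕ} {M : Matrix (Fin m) (Fin m) R[X][X]} {d : Fin m → ℕ}
    (h : ∀ i j, InnerDegreeLE (d j) (M i j)) : InnerDegreeLE (∑ j, d j) M.det := by
  rw [Matrix.det_apply']
  refine sum _ fun σ _ ↦ ?_
  rw [← zero_add (∑ j, d j)]
  refine mul ?_ (prod _ fun j _ ↦ h _ _)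
  rcases Int.units_eq_one_or (Equiv.Perm.sign σ) with h | h <;> rw [h]
  · simpa using one 0
  · intro i
    simpa using one (R := R) 0 i

end InnerDegreeLE

theorem innerDegreeLE_iterRes {n : ℕ} (hn : 1 ≤ n) : InnerDegreeLE (5 ^ n) (iterRes n) := by
  induction n, hn using Nat.le_induction with
  | base =>
    intro i
    have h : (gPoly (C X) X : ℤ[X][X]) =
        (X ^ 4 + 2 * X ^ 3 + 4 * X ^ 2 + 3 * X + 1 : ℤ[X]).map C * C (X ^ 5)
        - (X * (X ^ 4 - 3 * X ^ 3 + 4 * X ^ 2 - 2 * X + 1) : ℤ[X]).map C := by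
      simp [gPoly]
    rw [iterRes, h, coeff_sub, coeff_mul_C, coeff_map, coeff_map, pow_one]
    compute_degree
  | succ n hn ih =>
    have h := iterRes_succ_map (RingHom.id _) hn
    rw [map_id, map_id, resultant] at h
    rw [h]
    have hd : 5 ^ (n + 1) = ∑ j : Fin ((iterRes n).natDegree + 5),
        (Fin.addCases (fun _ ↦ 0) (fun _ ↦ 5 ^ n) j : ℕ) := by
      rw [Fin.sum_univ_add]
      simp [pow_succ']
    rw [hd]
    refine InnerDegreeLE.det fun i j ↦ ?_
    induction j using Fin.addCases with
    | left j =>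
      rw [sylvester, Matrix.of_apply, Fin.addCases_left, Fin.addCases_left]
      split_ifs
      · intro l
        rw [gPoly_X_C_eq]
        have h0 (z : ℤ[X][X]) (hz : ∃ w : ℤ[X], z = w.map C) (l : ℕ) :
            (z.coeff l).natDegree ≤ 0 := by
          obtain ⟨w, rfl⟩ := hz
          rw [coeff_map, natDegree_C]
        refine h0 _ ?_ l
        simp only [coeff_sub, coeff_C_mul, coeff_C, coeff_X_pow]
        split_ifs
        · exact ⟨X ^ 4 + 2 * X ^ 3 + 4 * X ^ 2 + 3 * X + 1
            - X * (X ^ 4 - 3 * X ^ 3 + 4 * X ^ 2 - 2 * X + 1), by simp⟩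
        · exact ⟨X ^ 4 + 2 * X ^ 3 + 4 * X ^ 2 + 3 * X + 1, by simp⟩
        · exact ⟨-(X * (X ^ 4 - 3 * X ^ 3 + 4 * X ^ 2 - 2 * X + 1)), by simp⟩
        · exact ⟨0, by simp⟩
      · exact InnerDegreeLE.zero _
    | right j =>
      rw [sylvester, Matrix.of_apply, Fin.addCases_right, Fin.addCases_right]
      split_ifs
      · intro l
        rw [coeff_map, coeff_C]
        split_ifs
        · exact ih _
        · simp
      · exact InnerDegreeLE.zero _

theorem Rdiag_natDegree_le {n : ℕ} (hn : 1 ≤ n) : (Rdiag n).natDegree ≤ 2 * 5 ^ n - 1 := by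
  have h5 : 1 ≤ 5 ^ n := Nat.one_le_pow _ _ (by norm_num)
  rw [Rdiag, eval_eq_sum_range, iterRes_natDegree hn]
  refine natDegree_sum_le_of_forall_le _ _ fun j hj ↦ ?_
  rw [Finset.mem_range] at hj
  rcases Nat.lt_succ_iff_lt_or_eq.1 hj with h | rfl
  · refine (natDegree_mul_le_of_le (innerDegreeLE_iterRes hn j) (natDegree_X_pow_le j)).trans ?_
    lia
  · have : (iterRes n).coeff (5 ^ n) = C ((-1) ^ n) := by
      rw [← iterRes_natDegree hn, ← leadingCoeff, iterRes_leadingCoeff hn]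
      simp
    rw [this]
    refine (natDegree_C_mul_le _ _).trans ((natDegree_X_pow_le _).trans ?_)
    lia

theorem natDegree_X_sub_two_pow_mul {B : Type*} [CommRing B] [IsDomain B] {n : ℕ} (hn : 1 ≤ n) :
    ((X - C (2 : B)) ^ (5 ^ n - 1) * (X - X ^ 5 ^ n)).natDegree = 2 * 5 ^ n - 1 := by
  have h5 : 1 < 5 ^ n := Nat.one_lt_pow (by lia) (by norm_num)
  have h1 : (X - X ^ 5 ^ n : B[X]).natDegree = 5 ^ n := by
    rw [natDegree_sub_eq_right_of_natDegree_lt] <;> simp [h5]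
  rw [natDegree_mul (pow_ne_zero _ (X_sub_C_ne_zero _)), natDegree_pow, natDegree_X_sub_C, h1]
  · lia
  · intro h
    rw [h, natDegree_zero] at h1
    lia

theorem Rdiag_natDegree {n : ℕ} (hn : 1 ≤ n) : (Rdiag n).natDegree = 2 * 5 ^ n - 1 := by
  refine le_antisymm (Rdiag_natDegree_le hn) ?_
  have h1 := natDegree_map_le (f := Int.castRingHom (ZMod 5)) (p := Rdiag n)
  rwa [Rdiag_map_charP_five hn, natDegree_C_mul (pow_ne_zero _ (by simp)),
    natDegree_X_sub_two_pow_mul hn] at h1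

/-- `R⁽ⁿ⁾(x, y)` depends on `x` only through `x⁵`. -/
theorem iterRes_map_congr {B : Type*} [CommRing B] (φ ψ : ℤ[X] →+* B) (h : φ X ^ 5 = ψ X ^ 5)
    {n : ℕ} (hn : 1 ≤ n) : (iterRes n).map φ = (iterRes n).map ψ := by
  induction n, hn using Nat.le_induction with
  | base =>
    rw [iterRes, ← coe_mapRingHom, map_gPoly, ← coe_mapRingHom, map_gPoly]
    have h' : (C (φ X) : B[X]) ^ 5 = C (ψ X) ^ 5 := by rw [← C_pow, h, C_pow]
    simp [gPoly, h']
  | succ n hn ih => rw [iterRes_succ_map φ hn, iterRes_succ_map ψ hn, ih]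

/-- `R⁽ⁿ⁾(0, y) = ± y + ⋯`: writing `R⁽ⁿ⁾(0, y) = y h(y)`, the resultant splits off the factor
`g(0, y) = -y + ⋯`, and the cofactor has constant term `± h(0)⁵`. -/
theorem iterRes_map_eval_zero_coeff {n : ℕ} (hn : 1 ≤ n) :
    ((iterRes n).map (evalRingHom 0)).coeff 0 = 0 ∧
      IsUnit (((iterRes n).map (evalRingHom 0)).coeff 1) := by
  induction n, hn using Nat.le_induction with
  | base =>
    rw [iterRes, ← coe_mapRingHom, map_gPoly]
    simp only [coe_mapRingHom, map_C, coe_evalRingHom, eval_X, map_X, gPoly_C_X_eq]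
    simp [coeff_X]
  | succ n hn ih =>
    set f := (iterRes n).map (evalRingHom (0 : ℤ)) with hf
    obtain ⟨h, hh⟩ : (X : ℤ[X]) ∣ f := X_dvd_iff.2 ih.1
    have hdeg : f.natDegree = 5 ^ n := by
      rw [hf, natDegree_map_of_leadingCoeff_ne_zero, iterRes_natDegree hn]
      rw [iterRes_leadingCoeff hn]
      simp
    have hdeg' : (iterRes n).natDegree =
        (X : ℤ[X][X]).natDegree + (h.map (C : ℤ →+* ℤ[X])).natDegree := by
      have h0 : h ≠ 0 := by
        rintro rfl
        rw [hh, mul_zero, natDegree_zero] at hdeg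
        exact (pow_ne_zero n (by norm_num)) hdeg.symm
      rw [iterRes_natDegree hn, ← hdeg, hh, natDegree_X_mul h0, natDegree_X, add_comm,
        natDegree_map_eq_of_injective C_injective]
    have h1 : (iterRes (n + 1)).map (evalRingHom (0 : ℤ)) =
        gPoly 0 X * resultant (h.map (C : ℤ →+* ℤ[X])) (gPoly X (C X))
          (h.map (C : ℤ →+* ℤ[X])).natDegree 5 := by
      rw [iterRes_succ_map _ hn, ← hf, hh, Polynomial.map_mul, map_X, hdeg',
        resultant_mul_left _ _ _ 5 (gPoly_X_C_natDegree_le _)]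
      congr 1
      have := resultant_X_sub_C_left (gPoly X (C X)) 5 (0 : ℤ[X]) (gPoly_X_C_natDegree_le _)
      rw [C_0, sub_zero] at this
      rw [natDegree_X, this, ← coe_evalRingHom, map_gPoly]
      simp
    have h5 : (gPoly X (C X) : ℤ[X][X]).map (evalRingHom 0) = X ^ 5 := by
      rw [← coe_mapRingHom, map_gPoly]
      simp [gPoly]
    have h2 : (resultant (h.map (C : ℤ →+* ℤ[X])) (gPoly X (C X))
          (h.map (C : ℤ →+* ℤ[X])).natDegree 5).coeff 0 =
          (-1) ^ (h.natDegree * 5) * h.coeff 0 ^ 5 := by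
      rw [coeff_zero_eq_eval_zero, ← coe_evalRingHom, ← resultant_map_map, map_map,
        natDegree_map_eq_of_injective C_injective, h5]
      rw [show (evalRingHom (0 : ℤ)).comp C = RingHom.id ℤ by ext; simp, map_id]
      exact resultant_X_pow_right _ _ _ le_rfl
    have h3 : gPoly 0 X = X * -(X ^ 4 - 3 * X ^ 3 + 4 * X ^ 2 - 2 * X + 1 : ℤ[X]) := by
      unfold gPoly
      ring
    rw [h1, h3, mul_assoc]
    refine ⟨coeff_X_mul_zero _, ?_⟩
    rw [coeff_X_mul, mul_coeff_zero, h2]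
    have h4 : f.coeff 1 = h.coeff 0 := by rw [hh, coeff_X_mul]
    rw [h4] at ih
    refine IsUnit.mul ?_ ((IsUnit.pow _ isUnit_neg_one).mul (ih.2.pow 5))
    simp [coeff_zero_eq_eval_zero]

/-- `Rₙ = ± x + ⋯`; in particular `Rₙ` is primitive. -/
theorem isUnit_coeff_one_Rdiag {n : ℕ} (hn : 1 ≤ n) : IsUnit ((Rdiag n).coeff 1) := by
  set f := (iterRes n).map (evalRingHom (0 : ℤ)) with hf
  let π : ℤ[X] →+* ℤ[X] ⧸ Ideal.span {(X : ℤ[X]) ^ 2} := Ideal.Quotient.mk _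
  have hX : π X ^ 2 = 0 := by
    rw [← map_pow, Ideal.Quotient.eq_zero_iff_mem]
    exact Ideal.mem_span_singleton_self _
  -- modulo `x²` the polynomials `R⁽ⁿ⁾(x, y)` and `R⁽ⁿ⁾(0, y)` agree
  have h1 : π (Rdiag n) = π f := by
    rw [map_Rdiag, iterRes_map_congr π ((π.comp C).comp (evalRingHom 0)) _ hn, ← map_map, ← hf,
      eval_map, ← hom_eval₂, eval₂_C_X]
    rw [show 5 = 2 + 3 by rfl, pow_add, pow_add, hX]
    simp
  rw [← sub_eq_zero, ← map_sub, Ideal.Quotient.eq_zero_iff_mem, Ideal.mem_span_singleton,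
    X_pow_dvd_iff] at h1
  have h2 := h1 1 one_lt_two
  rw [coeff_sub, sub_eq_zero] at h2
  rw [h2]
  exact (iterRes_map_eval_zero_coeff hn).2

theorem Rdiag_isPrimitive {n : ℕ} (hn : 1 ≤ n) : (Rdiag n).IsPrimitive := fun _ hr ↦
  isUnit_of_dvd_unit ((C_dvd_iff_dvd_coeff _ _).1 hr 1) (isUnit_coeff_one_Rdiag hn)

/-! ### The residue field of `ℚ̄₅` -/

/-- The ring of integers `‖x‖ ≤ 1` of `ℚ̄₅`. -/
noncomputable abbrev integers : ValuationSubring (PadicAlgCl 5) :=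
  (Valued.v (R := PadicAlgCl 5)).valuationSubring

/-- The residue field of `ℚ̄₅`. -/
abbrev ResidueF : Type := IsLocalRing.ResidueField integers

/-- The reduction map from the integers of `ℚ̄₅` to the residue field. -/
noncomputable abbrev res : integers →+* ResidueF := IsLocalRing.residue integers

theorem mem_integers {x : PadicAlgCl 5} : x ∈ integers ↔ ‖x‖ ≤ 1 := by
  rw [Valuation.mem_valuationSubring_iff, PadicAlgCl.valuation_def, ← NNReal.coe_le_coe, coe_nnnorm,
    NNReal.coe_one]

theorem res_eq_zero_iff {x : integers} : res x = 0 ↔ ‖(x : PadicAlgCl 5)‖ < 1 := by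
  rw [IsLocalRing.residue_eq_zero_iff, IsLocalRing.mem_maximalIdeal, mem_nonunits_iff, not_iff_comm,
    not_lt]
  constructor
  · intro h
    have hx0 : (x : PadicAlgCl 5) ≠ 0 := norm_pos_iff.1 (one_pos.trans_le h)
    have hinv : (x : PadicAlgCl 5)⁻¹ ∈ integers := by
      rw [mem_integers, norm_inv]
      exact inv_le_one_of_one_le₀ h
    exact IsUnit.of_mul_eq_one ⟨_, hinv⟩ (Subtype.ext (mul_inv_cancel₀ hx0))
  · rintro ⟨u, rfl⟩
    have h1 := mem_integers.1 (↑u⁻¹ : integers).2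
    have h2 : ‖((u : integers) : PadicAlgCl 5)‖ * ‖((↑u⁻¹ : integers) : PadicAlgCl 5)‖ = 1 := by
      rw [← norm_mul, ← MulMemClass.coe_mul, Units.mul_inv, OneMemClass.coe_one, norm_one]
    nlinarith [norm_nonneg ((u : integers) : PadicAlgCl 5)]

theorem res_eq_iff {x y : integers} : res x = res y ↔ ‖(x : PadicAlgCl 5) - y‖ < 1 := by
  rw [← sub_eq_zero, ← map_sub, res_eq_zero_iff, AddSubgroupClass.coe_sub]

theorem res_surjective : Function.Surjective res := IsLocalRing.residue_surjective

theorem norm_five : ‖(5 : PadicAlgCl 5)‖ = 1 / 5 := by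
  have := PadicAlgCl.valuation_p 5
  rw [PadicAlgCl.valuation_def, ← NNReal.coe_inj, coe_nnnorm] at this
  simpa using this

instance : CharP ResidueF 5 := by
  refine (CharP.charP_iff_prime_eq_zero Nat.prime_five).2 ?_
  have : res 5 = 0 := res_eq_zero_iff.2 (by
    change ‖(5 : PadicAlgCl 5)‖ < 1
    rw [norm_five]; norm_num)
  simpa only [map_ofNat, Nat.cast_ofNat] using this

/-- Monic polynomials lift to the integers, which are integrally closed in `ℚ̄₅`. -/
instance : IsAlgClosed ResidueF := by
  refine IsAlgClosed.of_exists_root _ fun p hp hirr ↦ ?_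
  obtain ⟨P, hP, hdeg, hPm⟩ := lifts_and_natDegree_eq_and_monic
    ((mem_lifts p).2 (map_surjective _ res_surjective p)) hp
  have hd : (P.map integers.subtype).degree ≠ 0 := by
    rw [hPm.degree_map]
    intro h
    have := natDegree_eq_of_degree_eq_some h
    rw [hdeg] at this
    exact hirr.natDegree_pos.ne' this
  obtain ⟨z, hz⟩ := IsAlgClosed.exists_root _ hd
  have hint : IsIntegral integers z := ⟨P, hPm, by rwa [IsRoot, eval_map] at hz⟩
  obtain ⟨w, rfl⟩ := IsIntegrallyClosed.isIntegral_iff.1 hint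
  refine ⟨res w, ?_⟩
  rw [← hP, eval_map, eval₂_at_apply]
  have h0 : P.eval w = 0 := by
    rw [IsRoot, eval_map] at hz
    have h1 := eval₂_at_apply (p := P) integers.subtype w
    refine Subtype.val_injective ?_
    exact h1.symm.trans hz
  rw [h0, map_zero]

theorem res_eq_two_iff {x : integers} : res x = 2 ↔ ‖(x : PadicAlgCl 5) - 2‖ < 1 := by
  rw [← map_ofNat res 2, res_eq_iff]
  rfl

/-! ### Reduction of `Rₙ` -/

theorem two_pow_five_pow {B : Type*} [CommRing B] [CharP B 5] (n : ℕ) :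
    (2 : B) ^ 5 ^ n = 2 := by
  have : ExpChar B 5 := ExpChar.prime Nat.prime_five
  have : iterateFrobenius B 5 n 2 = 2 := map_ofNat _ 2
  rwa [iterateFrobenius_def] at this

theorem eval_derivative_Rdiag_map {B : Type*} [CommRing B] [IsDomain B] [CharP B 5] {n : ℕ}
    (hn : 1 ≤ n) {α : B} (hα : α ^ 5 ^ n = α) (h2 : α ≠ 2) :
    (derivative ((Rdiag n).map (Int.castRingHom B))).eval α ≠ 0 := by
  have h5 : ((5 ^ n : ℕ) : B) = 0 := by
    rw [Nat.cast_pow]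
    rw [CharP.cast_eq_zero B 5, zero_pow (by lia)]
  rw [Rdiag_map_charP_five hn, derivative_C_mul, derivative_mul, eval_mul, eval_add, eval_mul,
    eval_mul]
  simp only [derivative_sub, derivative_X, derivative_X_pow, eval_sub, eval_X, eval_pow, eval_C,
    hα, sub_self, mul_zero, zero_add, h5, C_0, zero_mul, sub_zero, eval_one,
    mul_one]
  exact mul_ne_zero (pow_ne_zero _ (by simp)) (pow_ne_zero _ (sub_ne_zero.2 h2))

theorem Rdiag_map_eval_eq_zero {B : Type*} [CommRing B] [IsDomain B] [CharP B 5] {n : ℕ}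
    (hn : 1 ≤ n) {α : B} (hα : α ^ 5 ^ n = α) :
    ((Rdiag n).map (Int.castRingHom B)).eval α = 0 := by
  rw [Rdiag_map_charP_five hn]
  simp [hα]

theorem coe_eval_map_int (p : ℤ[X]) (x : integers) :
    (((p.map (Int.castRingHom integers)).eval x : integers) : PadicAlgCl 5) =
      aeval (x : PadicAlgCl 5) p := by
  have h := hom_eval₂ p (Int.castRingHom integers) integers.subtype x
  rw [eval_map, aeval_def, ← RingHom.ext_int (integers.subtype.comp (Int.castRingHom integers))
    (algebraMap ℤ (PadicAlgCl 5))]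
  exact h

theorem res_eval_map_int (p : ℤ[X]) (x : integers) :
    res ((p.map (Int.castRingHom integers)).eval x) =
      (p.map (Int.castRingHom ResidueF)).eval (res x) := by
  rw [eval_map, hom_eval₂, eval_map, RingHom.ext_int (res.comp (Int.castRingHom integers))
    (Int.castRingHom ResidueF)]

/-- A periodic point of period `n` outside the residue class of `2` is determined by its residue
class. -/
theorem HasPeriod.eq_of_norm_sub_lt {n : ℕ} (hn : 1 ≤ n) {a b : PadicAlgCl 5}
    (ha : HasPeriod (PadicAlgCl 5) n a) (hb : HasPeriod (PadicAlgCl 5) n b) (ha2 : 1 ≤ ‖a - 2‖)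
    (hab : ‖a - b‖ < 1) : a = b := by
  by_contra hne
  lift a to integers using mem_integers.2 (ha.norm_le_one hn)
  lift b to integers using mem_integers.2 (hb.norm_le_one hn)
  set f := (Rdiag n).map (Int.castRingHom integers) with hf
  have hroot {x : integers} (hx : HasPeriod (PadicAlgCl 5) n x) : f.eval x = 0 := by
    refine Subtype.val_injective ((coe_eval_map_int _ _).trans ?_)
    exact (aeval_Rdiag_eq_zero_iff hn _).2 hx
  obtain ⟨Q, hQ⟩ := dvd_iff_isRoot.2 (hroot ha)
  have hQb : Q.eval b = 0 := by
    have h1 := hroot hb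
    rw [hQ, eval_mul, eval_sub, eval_X, eval_C, mul_eq_zero, sub_eq_zero] at h1
    exact h1.resolve_left fun h ↦ hne (congrArg Subtype.val h.symm)
  have hres : res b = res a := (res_eq_iff.2 hab).symm
  have hQa : (Q.map res).eval (res a) = 0 := by
    rw [← hres, eval_map, eval₂_at_apply, hQb, map_zero]
  have hfr : (Rdiag n).map (Int.castRingHom ResidueF) = f.map res := by
    rw [hf, map_map]
    congr 1
  have ha2' : res a ≠ 2 := fun h ↦ not_lt.2 ha2 (res_eq_two_iff.1 h)
  have hpow : res a ^ 5 ^ n = res a := by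
    rw [← map_pow, res_eq_iff]
    exact ha.norm_pow_sub_lt norm_five hn ha2
  refine eval_derivative_Rdiag_map hn hpow ha2' ?_
  rw [hfr, hQ, Polynomial.map_mul, derivative_mul, eval_add, eval_mul, eval_mul, hQa]
  simp

theorem norm_leadingCoeff_Rdiag {n : ℕ} (hn : 1 ≤ n) :
    ‖((Rdiag n).leadingCoeff : PadicAlgCl 5)‖ = 1 := by
  refine le_antisymm ?_ ?_
  · exact mem_integers.1 (intCast_mem integers _)
  · by_contra! h
    have h0 : ((Rdiag n).leadingCoeff : ResidueF) = 0 := by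
      have := res_eq_zero_iff (x := ((Rdiag n).leadingCoeff : integers)).2 (by simpa using h)
      simpa using this
    have h1 := natDegree_X_sub_two_pow_mul (B := ResidueF) hn
    have h2 : ((Rdiag n).map (Int.castRingHom ResidueF)).natDegree = 2 * 5 ^ n - 1 := by
      rw [Rdiag_map_charP_five hn, natDegree_C_mul (pow_ne_zero _ (by simp)), h1]
    have h3 : ((Rdiag n).map (Int.castRingHom ResidueF)).leadingCoeff = 0 := by
      rw [leadingCoeff, h2, coeff_map, ← Rdiag_natDegree hn]
      exact h0
    rw [leadingCoeff_eq_zero] at h3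
    rw [h3, natDegree_zero] at h2
    have : 1 ≤ 5 ^ n := Nat.one_le_pow _ _ (by norm_num)
    lia

theorem Rdiag_ne_zero {n : ℕ} (hn : 1 ≤ n) : Rdiag n ≠ 0 := (Rdiag_isPrimitive hn).ne_zero

theorem exists_root_near {K : Type*} [NormedField K] (S : Multiset K) (x : K)
    (h : ‖(S.map fun r ↦ x - r).prod‖ < 1) : ∃ r ∈ S, ‖x - r‖ < 1 := by
  by_contra! hcon
  refine not_le.2 h ?_
  induction S using Multiset.induction with
  | empty => simp
  | cons a S ih =>
    rw [Multiset.map_cons, Multiset.prod_cons, norm_mul]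
    have h1 : 1 ≤ ‖(S.map fun r ↦ x - r).prod‖ := by
      by_contra! h2
      exact absurd (ih h2 fun r hr ↦ hcon r (Multiset.mem_cons_of_mem hr)) (not_le.2 h2)
    exact one_le_mul_of_one_le_of_one_le (hcon a (Multiset.mem_cons_self a S)) h1

theorem mem_aroots_Rdiag {n : ℕ} (hn : 1 ≤ n) {a : PadicAlgCl 5} :
    a ∈ (Rdiag n).aroots (PadicAlgCl 5) ↔ HasPeriod (PadicAlgCl 5) n a := by
  rw [mem_aroots, aeval_Rdiag_eq_zero_iff hn, and_iff_right (Rdiag_ne_zero hn)]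

/-- Every residue class that is fixed by the `n`-th power of Frobenius contains a point of
period `n`. -/
theorem exists_hasPeriod_near {n : ℕ} (hn : 1 ≤ n) (x : integers)
    (hx : res x ^ 5 ^ n = res x) :
    ∃ a, HasPeriod (PadicAlgCl 5) n a ∧ ‖(x : PadicAlgCl 5) - a‖ < 1 := by
  have h1 : ‖aeval (x : PadicAlgCl 5) (Rdiag n)‖ < 1 := by
    rw [← coe_eval_map_int, ← res_eq_zero_iff, res_eval_map_int]
    exact Rdiag_map_eval_eq_zero hn hx
  rw [aeval_def, ← eval_map, (IsAlgClosed.splits ((Rdiag n).map _)).eq_prod_roots, eval_mul,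
    eval_C, leadingCoeff_map_of_injective (algebraMap ℤ (PadicAlgCl 5)).injective_int, norm_mul,
    eq_intCast, norm_leadingCoeff_Rdiag hn, one_mul, eval_multiset_prod,
    Multiset.map_map] at h1
  obtain ⟨a, ha, hxa⟩ := exists_root_near _ (x : PadicAlgCl 5)
    (by simpa [Function.comp_def] using h1)
  exact ⟨a, (mem_aroots_Rdiag hn).1 ha, hxa⟩

/-! ### Periods -/

theorem HasPeriod.of_dvd {A : Type*} [CommRing A] {m n : ℕ} (h : m ∣ n) (hm : 1 ≤ m) {a : A}
    (ha : HasPeriod A m a) : HasPeriod A n a := by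
  obtain ⟨c, h0, h1, hc⟩ := ha
  refine ⟨fun i ↦ c (i % m), by simpa using h0, by simpa [Nat.mod_eq_zero_of_dvd h] using h0,
    fun i _ ↦ ?_⟩
  have hi := Nat.mod_lt i hm
  have h2 := hc _ hi
  rcases Nat.lt_or_ge (i % m + 1) m with h3 | h3
  · have : (i + 1) % m = i % m + 1 := by
      rw [← Nat.mod_eq_of_lt h3, Nat.mod_add_mod]
    simpa [this] using h2
  · have h4 : i % m + 1 = m := by lia
    have : (i + 1) % m = 0 := by
      rw [← Nat.mod_add_mod, h4, Nat.mod_self]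
    simpa [this, h0, h4, h1] using h2

/-- Two periodic points in the same residue class, not the class of `2`, are equal. -/
theorem HasPeriod.eq_of_res_eq {m n : ℕ} (hm : 1 ≤ m) (hn : 1 ≤ n) {a b : integers}
    (ha : HasPeriod (PadicAlgCl 5) m a) (hb : HasPeriod (PadicAlgCl 5) n b) (ha2 : res a ≠ 2)
    (hab : res a = res b) : a = b := by
  refine Subtype.ext (HasPeriod.eq_of_norm_sub_lt (Nat.mul_pos hm hn)
    (ha.of_dvd (Dvd.intro _ rfl) hm) (hb.of_dvd (Dvd.intro_left _ rfl) hn) ?_ (res_eq_iff.1 hab))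
  by_contra! h
  exact ha2 (res_eq_two_iff.2 h)

theorem isPeriodicPt_frobenius_iff {B : Type*} [CommRing B] [CharP B 5] {n : ℕ} {α : B} :
    Function.IsPeriodicPt (frobenius B 5) n α ↔ α ^ 5 ^ n = α := by
  rw [Function.IsPeriodicPt, Function.IsFixedPt, ← coe_iterateFrobenius, iterateFrobenius_def]

/-- Outside the class of `2`, the periods of a periodic point are those of its residue class under
Frobenius. -/
theorem hasPeriod_iff_minimalPeriod_dvd {m n : ℕ} (hm : 1 ≤ m) (hn : 1 ≤ n) {a : integers}
    (ha : HasPeriod (PadicAlgCl 5) m a) (ha2 : res a ≠ 2) : HasPeriod (PadicAlgCl 5) n a ↔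
      Function.minimalPeriod (frobenius ResidueF 5) (res a) ∣ n := by
  rw [← Function.isPeriodicPt_iff_minimalPeriod_dvd, isPeriodicPt_frobenius_iff]
  constructor
  · intro h
    rw [← map_pow, res_eq_iff]
    refine h.norm_pow_sub_lt norm_five hn ?_
    by_contra! h
    exact ha2 (res_eq_two_iff.2 h)
  · intro h
    obtain ⟨b, hb, hab⟩ := exists_hasPeriod_near hn a h
    lift b to integers using mem_integers.2 (hb.norm_le_one hn)
    rwa [ha.eq_of_res_eq hm hn hb ha2 (res_eq_iff.2 hab)]

theorem minimalPeriod_pos_of_hasPeriod {m : ℕ} (hm : 1 ≤ m) {a : integers}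
    (ha : HasPeriod (PadicAlgCl 5) m a) (ha2 : res a ≠ 2) :
    1 ≤ Function.minimalPeriod (frobenius ResidueF 5) (res a) :=
  Nat.pos_of_dvd_of_pos ((hasPeriod_iff_minimalPeriod_dvd hm hm ha ha2).1 ha) hm

section Fricke

variable {s : PadicAlgCl 5} (hs : s ^ 2 = 5)
include hs

theorem hasPeriod_fricke_iff {a : PadicAlgCl 5} (he : a ≠ frickePole s) (n : ℕ) :
    HasPeriod (PadicAlgCl 5) n (fricke s a) ↔ HasPeriod (PadicAlgCl 5) n a := by
  refine ⟨fun h ↦ ?_, fun h ↦ h.map_fricke hs he⟩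
  rw [← fricke_fricke hs he]
  exact h.map_fricke hs (fricke_ne_pole hs he)

theorem ne_frickePole_of_one_le {a : PadicAlgCl 5} (ha : 1 ≤ ‖a - 2‖) : a ≠ frickePole s := by
  rintro rfl
  exact not_lt.2 ha (frickePole_norm_sub_two_lt norm_five hs)

/-- The periods of a periodic point are the multiples of one of them. -/
theorem exists_period_dvd_iff {m : ℕ} (hm : 1 ≤ m) {a : PadicAlgCl 5}
    (ha : HasPeriod (PadicAlgCl 5) m a) :
    ∃ d, 1 ≤ d ∧ ∀ n, 1 ≤ n → (HasPeriod (PadicAlgCl 5) n a ↔ d ∣ n) := by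
  have key {b : PadicAlgCl 5} (hb : HasPeriod (PadicAlgCl 5) m b) (hb2 : 1 ≤ ‖b - 2‖) :
      ∃ d, 1 ≤ d ∧ ∀ n, 1 ≤ n → (HasPeriod (PadicAlgCl 5) n b ↔ d ∣ n) := by
    lift b to integers using mem_integers.2 (hb.norm_le_one hm)
    have hb2' : res b ≠ 2 := fun h ↦ not_lt.2 hb2 (res_eq_two_iff.1 h)
    exact ⟨_, minimalPeriod_pos_of_hasPeriod hm hb hb2', fun n hn ↦
      hasPeriod_iff_minimalPeriod_dvd hm hn hb hb2'⟩
  by_cases ha2 : 1 ≤ ‖a - 2‖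
  · exact key ha ha2
  by_cases he : a = frickePole s
  · exact ⟨1, le_rfl, fun n _ ↦ by simpa [he] using hasPeriod_frickePole hs n⟩
  obtain ⟨d, hd, h⟩ := key (ha.map_fricke hs he)
    (ha.one_le_norm_fricke_sub_two norm_five hs hm (not_le.1 ha2) he)
  exact ⟨d, hd, fun n hn ↦ by rw [← h n hn, hasPeriod_fricke_iff hs he]⟩

theorem HasMinimalPeriod.hasPeriod_iff {n : ℕ} {a : PadicAlgCl 5}
    (ha : HasMinimalPeriod (PadicAlgCl 5) n a) {m : ℕ} (hm : 1 ≤ m) :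
    HasPeriod (PadicAlgCl 5) m a ↔ n ∣ m := by
  obtain ⟨d, hd, h⟩ := exists_period_dvd_iff hs ha.1.1 ha.1.2
  have h1 : n = d := le_antisymm (ha.2 ⟨hd, (h d hd).2 dvd_rfl⟩)
    (Nat.le_of_dvd ha.1.1 ((h n ha.1.1).1 ha.1.2))
  rw [h m hm, h1]

theorem exists_hasMinimalPeriod {m : ℕ} (hm : 1 ≤ m) {a : PadicAlgCl 5}
    (ha : HasPeriod (PadicAlgCl 5) m a) : ∃ d, d ∣ m ∧ HasMinimalPeriod (PadicAlgCl 5) d a := by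
  obtain ⟨d, hd, h⟩ := exists_period_dvd_iff hs hm ha
  exact ⟨d, (h m hm).1 ha, ⟨hd, (h d hd).2 dvd_rfl⟩, fun k hk ↦
    Nat.le_of_dvd hk.1 ((h k hk.1).1 hk.2)⟩

/-! ### Simplicity of the roots of `Rₙ` -/

/-- The `5ⁿ - 1` residue classes other than `2` each contain a root of `Rₙ`; with the images of
these roots under the Fricke involution and its pole they make up `2 · 5ⁿ - 1 = deg Rₙ` roots. -/
theorem nodup_aroots_Rdiag {n : ℕ} (hn : 1 ≤ n) : ((Rdiag n).aroots (PadicAlgCl 5)).Nodup := by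
  classical
  have h5n : 1 < 5 ^ n := Nat.one_lt_pow (by lia) (by norm_num)
  set p : ResidueF[X] := X ^ 5 ^ n - X with hp
  have hpdeg : p.natDegree = 5 ^ n :=
    FiniteField.X_pow_card_pow_sub_X_natDegree_eq _ (by lia) (by norm_num)
  have hp0 : p ≠ 0 := by
    intro h
    rw [h, natDegree_zero] at hpdeg
    lia
  have hpsep : p.Separable := galois_poly_separable 5 _ (dvd_pow_self _ (by lia))
  have hproot {α : ResidueF} : α ∈ p.roots.toFinset ↔ α ^ 5 ^ n = α := by
    rw [Multiset.mem_toFinset, mem_roots hp0, IsRoot, hp, eval_sub, eval_pow, eval_X, sub_eq_zero]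
  have hpcard : p.roots.toFinset.card = 5 ^ n := by
    rw [Multiset.toFinset_card_of_nodup (nodup_roots hpsep),
      ← (IsAlgClosed.splits p).natDegree_eq_card_roots, hpdeg]
  set T := p.roots.toFinset.erase 2 with hT
  have hTcard : T.card = 5 ^ n - 1 := by
    rw [hT, Finset.card_erase_of_mem, hpcard]
    exact hproot.2 (two_pow_five_pow n)
  have hex (α : ResidueF) : ∃ a : integers, α ∈ T → HasPeriod (PadicAlgCl 5) n a ∧ res a = α := by
    obtain ⟨x, rfl⟩ := res_surjective α
    by_cases hx : res x ∈ T
    · obtain ⟨a, ha, hxa⟩ := exists_hasPeriod_near hn x (hproot.1 (Finset.mem_of_mem_erase hx))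
      lift a to integers using mem_integers.2 (ha.norm_le_one hn)
      exact ⟨a, fun _ ↦ ⟨ha, (res_eq_iff.2 hxa).symm⟩⟩
    · exact ⟨0, fun h ↦ absurd h hx⟩
  choose lift hlift using hex
  set S := T.image fun α ↦ (lift α : PadicAlgCl 5) with hS
  have hSnear {a : PadicAlgCl 5} (ha : a ∈ S) :
      HasPeriod (PadicAlgCl 5) n a ∧ 1 ≤ ‖a - 2‖ := by
    obtain ⟨α, hα, rfl⟩ := Finset.mem_image.1 ha
    obtain ⟨h1, h2⟩ := hlift α hα
    refine ⟨h1, ?_⟩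
    by_contra! h
    rw [← res_eq_two_iff, h2] at h
    exact Finset.ne_of_mem_erase hα h
  have hScard : S.card = 5 ^ n - 1 := by
    rw [hS, Finset.card_image_of_injOn, hTcard]
    intro α hα β hβ h
    rw [← (hlift α hα).2, ← (hlift β hβ).2, Subtype.val_injective h]
  have hSpole {a : PadicAlgCl 5} (ha : a ∈ S) : a ≠ frickePole s :=
    ne_frickePole_of_one_le hs (hSnear ha).2
  set S' := S.image (fricke s) with hS'
  have hS'near {a : PadicAlgCl 5} (ha : a ∈ S') : HasPeriod (PadicAlgCl 5) n a ∧ ‖a - 2‖ < 1 ∧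
      a ≠ frickePole s := by
    obtain ⟨b, hb, rfl⟩ := Finset.mem_image.1 ha
    have hb1 := hSnear hb
    exact ⟨hb1.1.map_fricke hs (hSpole hb), norm_fricke_sub_two_lt norm_five hs (hSpole hb)
      (hb1.1.norm_le_one hn) hb1.2, fricke_ne_pole hs (hSpole hb)⟩
  have hS'card : S'.card = 5 ^ n - 1 := by
    rw [hS', Finset.card_image_of_injOn, hScard]
    intro a ha b hb h
    rw [← fricke_fricke hs (hSpole ha), h, fricke_fricke hs (hSpole hb)]
  have hdisj : Disjoint S S' := Finset.disjoint_left.2 fun a ha ha' ↦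
    not_lt.2 (hSnear ha).2 (hS'near ha').2.1
  have hpole : frickePole s ∉ S ∪ S' := fun h ↦ by
    rcases Finset.mem_union.1 h with h | h
    · exact hSpole h rfl
    · exact (hS'near h).2.2 rfl
  have hcard : (insert (frickePole s) (S ∪ S')).card = 2 * 5 ^ n - 1 := by
    rw [Finset.card_insert_of_notMem hpole, Finset.card_union_of_disjoint hdisj, hScard, hS'card]
    lia
  have hsub : insert (frickePole s) (S ∪ S') ⊆ ((Rdiag n).aroots (PadicAlgCl 5)).toFinset := by
    intro a ha
    rw [Multiset.mem_toFinset, mem_aroots_Rdiag hn]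
    rcases Finset.mem_insert.1 ha with rfl | h
    · exact hasPeriod_frickePole hs n
    rcases Finset.mem_union.1 h with h | h
    · exact (hSnear h).1
    · exact (hS'near h).1
  rw [← Multiset.toFinset_card_eq_card_iff_nodup]
  refine le_antisymm (Multiset.toFinset_card_le _) ?_
  calc _ ≤ ((Rdiag n).map (algebraMap ℤ (PadicAlgCl 5))).natDegree := card_roots' _
    _ ≤ (Rdiag n).natDegree := natDegree_map_le
    _ = _ := by rw [Rdiag_natDegree hn, hcard]
    _ ≤ _ := Finset.card_le_card hsub

end Fricke

/-! ### The polynomials `Pₙ` -/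

open Classical in
/-- The polynomial `Pₙ`, as the quotient of `Rₙ` by the product of the `P_d` for the proper divisors
`d` of `n` (with value `0` if the division in `ℤ[x]` were not possible). -/
noncomputable def dynatomic (n : ℕ) : ℤ[X] :=
  if h : ∃ Q, Rdiag n = (∏ d ∈ n.properDivisors.attach, dynatomic d) * Q then h.choose else 0
termination_by n
decreasing_by exact (Nat.mem_properDivisors.1 d.2).2

theorem Rdiag_eq_mul_dynatomic_of_dvd {n : ℕ}
    (h : ∏ d ∈ n.properDivisors, dynatomic d ∣ Rdiag n) :
    Rdiag n = (∏ d ∈ n.properDivisors, dynatomic d) * dynatomic n := by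
  have h' : ∃ Q, Rdiag n = (∏ d ∈ n.properDivisors.attach, dynatomic d) * Q := by
    rw [Finset.prod_attach _ dynatomic]
    exact h
  conv_rhs => rw [dynatomic, dif_pos h', ← Finset.prod_attach]
  exact h'.choose_spec

/-- Divisibility by a primitive polynomial can be tested over a field of characteristic zero. -/
theorem dvd_of_map_dvd {K : Type*} [Field K] [CharZero K] {P Q : ℤ[X]} (hP : P.IsPrimitive)
    (h : P.map (Int.castRingHom K) ∣ Q.map (Int.castRingHom K)) : P ∣ Q := by
  rw [IsPrimitive.Int.dvd_iff_map_cast_dvd_map_cast _ _ hP,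
    ← map_dvd_map' (algebraMap ℚ K), map_map, map_map]
  rwa [RingHom.ext_int ((algebraMap ℚ K).comp (Int.castRingHom ℚ)) (Int.castRingHom K)]

theorem HasMinimalPeriod.unique {A : Type*} [CommRing A] {m n : ℕ} {a : A}
    (hm : HasMinimalPeriod A m a) (hn : HasMinimalPeriod A n a) : m = n := IsLeast.unique hm hn

section

variable {s : PadicAlgCl 5} (hs : s ^ 2 = 5)
include hs

/-- If the recursion holds below `n`, then the product of the `P_d`, for the proper divisors `d` of
`n`, divides `Rₙ`: over `ℚ̄₅` these factors are pairwise coprime, and each has simple roots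
only, which are roots of `Rₙ`. -/
theorem prod_dynatomic_dvd {n : ℕ} (hn : 1 ≤ n) (h : ∀ d ∈ n.properDivisors, dynatomic d ∣ Rdiag d ∧
      ∀ a : PadicAlgCl 5, aeval a (dynatomic d) = 0 ↔ HasMinimalPeriod (PadicAlgCl 5) d a) :
    ∏ d ∈ n.properDivisors, dynatomic d ∣ Rdiag n := by
  have hcast : algebraMap ℤ (PadicAlgCl 5) = Int.castRingHom (PadicAlgCl 5) := RingHom.ext_int _ _
  have hpos {d : ℕ} (hd : d ∈ n.properDivisors) : 1 ≤ d := Nat.pos_of_mem_properDivisors hd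
  have hdvd {d : ℕ} (hd : d ∈ n.properDivisors) : dynatomic d ∣ Rdiag n := by
    have hprim := isPrimitive_of_dvd (Rdiag_isPrimitive (hpos hd)) (h d hd).1
    refine dvd_of_map_dvd (K := PadicAlgCl 5) hprim ?_
    rw [← hcast]
    refine (IsAlgClosed.splits _).dvd_of_roots_le_roots
      ((Polynomial.map_ne_zero_iff (algebraMap ℤ (PadicAlgCl 5)).injective_int).2 hprim.ne_zero) ?_
    have hnd : ((dynatomic d).map (algebraMap ℤ (PadicAlgCl 5))).roots.Nodup :=
      Multiset.nodup_of_le (roots.le_of_dvd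
        ((Polynomial.map_ne_zero_iff (algebraMap ℤ (PadicAlgCl 5)).injective_int).2
          (Rdiag_ne_zero (hpos hd)))
        (Polynomial.map_dvd _ (h d hd).1)) (nodup_aroots_Rdiag hs (hpos hd))
    refine (Multiset.le_iff_subset hnd).2 fun a ha ↦ ?_
    have ha' := (mem_aroots.1 ha).2
    rw [(h d hd).2] at ha'
    exact (mem_aroots_Rdiag hn).2 (ha'.1.2.of_dvd (Nat.mem_properDivisors.1 hd).1 (hpos hd))
  refine dvd_of_map_dvd (K := PadicAlgCl 5) ?_ ?_
  · refine Finset.prod_induction _ IsPrimitive (fun _ _ ↦ IsPrimitive.mul) isPrimitive_one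
      fun d hd ↦ isPrimitive_of_dvd (Rdiag_isPrimitive (hpos hd)) (h d hd).1
  · rw [Polynomial.map_prod]
    refine Finset.prod_dvd_of_coprime (fun d hd e he hde ↦ ?_)
      fun d hd ↦ Polynomial.map_dvd _ (hdvd hd)
    rw [Function.onFun, isCoprime_iff_aeval_ne_zero_of_isAlgClosed (PadicAlgCl 5) (PadicAlgCl 5)]
    intro a
    by_contra! hcon
    simp only [coe_aeval_eq_eval, eval_map, ← hcast, ← aeval_def] at hcon
    rw [(h d hd).2, (h e he).2] at hcon
    exact hde (hcon.1.unique hcon.2)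

theorem dynatomic_spec {n : ℕ} (hn : 1 ≤ n) :
    Rdiag n = (∏ d ∈ n.properDivisors, dynatomic d) * dynatomic n ∧
      ∀ a : PadicAlgCl 5, aeval a (dynatomic n) = 0 ↔ HasMinimalPeriod (PadicAlgCl 5) n a := by
  induction n using Nat.strong_induction_on with
  | _ n ih =>
    have ih' {d : ℕ} (hd : d ∈ n.properDivisors) :=
      ih d (Nat.mem_properDivisors.1 hd).2 (Nat.pos_of_mem_properDivisors hd)
    have hR := Rdiag_eq_mul_dynatomic_of_dvd (prod_dynatomic_dvd hs hn fun d hd ↦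
      ⟨Dvd.intro_left _ (ih' hd).1.symm, (ih' hd).2⟩)
    refine ⟨hR, fun a ↦ ⟨fun ha ↦ ?_, fun ha ↦ ?_⟩⟩
    · have ha' : HasPeriod (PadicAlgCl 5) n a := by
        rw [← aeval_Rdiag_eq_zero_iff hn, hR, map_mul, ha, mul_zero]
      obtain ⟨d, hd, had⟩ := exists_hasMinimalPeriod hs hn ha'
      rcases (Nat.le_of_dvd hn hd).eq_or_lt with rfl | hlt
      · exact had
      -- otherwise `a` would be a multiple root of `Rₙ`
      exfalso
      have hd' : d ∈ n.properDivisors := Nat.mem_properDivisors.2 ⟨hd, hlt⟩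
      have hnd := nodup_aroots_Rdiag hs hn
      have h0 := Rdiag_ne_zero hn
      rw [hR] at hnd h0
      rw [aroots_mul h0, Multiset.nodup_add] at hnd
      refine Multiset.disjoint_left.1 hnd.2.2 (?_ : a ∈ _) ?_
      · rw [mem_aroots]
        refine ⟨left_ne_zero_of_mul h0, ?_⟩
        rw [map_prod]
        exact Finset.prod_eq_zero hd' (((ih' hd').2 a).2 had)
      · exact mem_aroots.2 ⟨right_ne_zero_of_mul h0, ha⟩
    · have ha' := (aeval_Rdiag_eq_zero_iff hn a).2 ha.1.2
      rw [hR, map_mul, map_prod, mul_eq_zero, Finset.prod_eq_zero_iff] at ha'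
      refine ha'.resolve_left ?_
      rintro ⟨d, hd, had⟩
      rw [(ih' hd).2] at had
      exact (Nat.mem_properDivisors.1 hd).2.ne (had.unique ha)

theorem prod_dynatomic {n : ℕ} (hn : 1 ≤ n) : ∏ d ∈ n.divisors, dynatomic d = Rdiag n := by
  rw [← Nat.insert_self_properDivisors (by lia), Finset.prod_insert Nat.self_notMem_properDivisors,
    mul_comm, ← (dynatomic_spec hs hn).1]

theorem dynatomic_ne_zero {n : ℕ} (hn : 1 ≤ n) : dynatomic n ≠ 0 := by
  have := Rdiag_ne_zero hn
  rw [(dynatomic_spec hs hn).1] at this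
  exact right_ne_zero_of_mul this

theorem nodup_aroots_dynatomic {n : ℕ} (hn : 1 ≤ n) :
    ((dynatomic n).aroots (PadicAlgCl 5)).Nodup := by
  have hnd := nodup_aroots_Rdiag hs hn
  have h0 := Rdiag_ne_zero hn
  rw [(dynatomic_spec hs hn).1] at hnd h0
  rw [aroots_mul h0, Multiset.nodup_add] at hnd
  exact hnd.2.1

theorem algebraMap_dynatomic {n : ℕ} (hn : 1 ≤ n) :
    algebraMap ℤ[X] (FractionRing ℤ[X]) (dynatomic n) = Pfrac n := by
  have hinj := IsFractionRing.injective ℤ[X] (FractionRing ℤ[X])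
  have h := (ArithmeticFunction.prod_eq_iff_prod_pow_moebius_eq_of_nonzero
    (f := fun n ↦ algebraMap ℤ[X] (FractionRing ℤ[X]) (dynatomic n))
    (g := fun n ↦ algebraMap ℤ[X] (FractionRing ℤ[X]) (Rdiag n))
    (fun n hn ↦ (map_ne_zero_iff _ hinj).2 (dynatomic_ne_zero hs hn))
    (fun n hn ↦ (map_ne_zero_iff _ hinj).2 (Rdiag_ne_zero hn))).1
    (fun n hn ↦ by rw [← map_prod, prod_dynatomic hs hn]) n hn
  rw [← h, Pfrac, Nat.prod_divisorsAntidiagonal'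
    fun i j ↦ algebraMap ℤ[X] (FractionRing ℤ[X]) (Rdiag j) ^ ArithmeticFunction.moebius i]

theorem natDegree_dynatomic {n : ℕ} (hn : 1 ≤ n) : ((dynatomic n).natDegree : ℤ) =
    ∑ k ∈ n.divisors, ArithmeticFunction.moebius (n / k) * (2 * 5 ^ k - 1) := by
  have h := (ArithmeticFunction.sum_eq_iff_sum_mul_moebius_eq
    (f := fun n ↦ ((dynatomic n).natDegree : ℤ)) (g := fun n ↦ 2 * 5 ^ n - 1)).1
    (fun n hn ↦ by
      rw [← Nat.cast_sum, ← natDegree_prod _ _ fun d hd ↦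
        dynatomic_ne_zero hs (Nat.pos_of_mem_divisors hd), prod_dynatomic hs hn,
        Rdiag_natDegree hn, Nat.cast_sub]
      · push_cast; ring
      · have : 1 ≤ 5 ^ n := Nat.one_le_pow _ _ (by norm_num)
        lia) n hn
  simp only [Int.cast_id] at h
  rw [← h, Nat.sum_divisorsAntidiagonal' fun i j ↦ ArithmeticFunction.moebius i * (2 * 5 ^ j - 1)]

theorem natDegree_dynatomic_one : (dynatomic 1).natDegree = 9 := by
  have h := natDegree_dynatomic hs le_rfl
  simp at h
  lia

theorem natDegree_dynatomic_of_one_lt {n : ℕ} (hn : 1 < n) : ((dynatomic n).natDegree : ℤ) =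
    2 * ∑ k ∈ n.divisors, ArithmeticFunction.moebius (n / k) * 5 ^ k := by
  have h0 : ∑ k ∈ n.divisors, ArithmeticFunction.moebius (n / k) = 0 := by
    rw [Nat.sum_div_divisors n fun k ↦ ArithmeticFunction.moebius k,
      ← ArithmeticFunction.coe_mul_zeta_apply, ArithmeticFunction.moebius_mul_coe_zeta,
      ArithmeticFunction.one_apply_ne hn.ne']
  rw [natDegree_dynatomic hs hn.le, Finset.mul_sum, ← sub_zero (∑ k ∈ n.divisors, 2 * _), ← h0,
    ← Finset.sum_sub_distrib]
  exact Finset.sum_congr rfl fun k _ ↦ by ring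

end

/-! ### Residues of elements of `ℚ₅(√5)` -/

theorem norm_algEquiv (σ : Gal(PadicAlgCl 5/ℚ_[5])) (x : PadicAlgCl 5) : ‖σ x‖ = ‖x‖ :=
  (spectralNorm_eq_of_equiv σ x).symm

theorem norm_algebraMap_padic (x : ℚ_[5]) : ‖algebraMap ℚ_[5] (PadicAlgCl 5) x‖ = ‖x‖ :=
  PadicAlgCl.norm_extends 5 x

section Sqrt

variable {s : PadicAlgCl 5} (hs : s ^ 2 = 5)
include hs

theorem exists_eq_add_mul_of_mem_adjoin {c : PadicAlgCl 5}
    (hc : c ∈ IntermediateField.adjoin ℚ_[5] {s}) : ∃ x y : ℚ_[5],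
      c = algebraMap ℚ_[5] (PadicAlgCl 5) x + algebraMap ℚ_[5] (PadicAlgCl 5) y * s := by
  rw [← IntermediateField.mem_toSubalgebra,
    IntermediateField.adjoin_simple_toSubalgebra_of_isAlgebraic (Algebra.IsAlgebraic.isAlgebraic s)]
    at hc
  induction hc using Algebra.adjoin_induction with
  | mem x hx =>
    obtain rfl : x = s := hx
    exact ⟨0, 1, by simp⟩
  | algebraMap r => exact ⟨r, 0, by simp⟩
  | add u v _ _ hu hv =>
    obtain ⟨x, y, rfl⟩ := hu
    obtain ⟨x', y', rfl⟩ := hv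
    exact ⟨x + x', y + y', by rw [map_add, map_add]; ring⟩
  | mul u v _ _ hu hv =>
    obtain ⟨x, y, rfl⟩ := hu
    obtain ⟨x', y', rfl⟩ := hv
    refine ⟨x * x' + 5 * (y * y'), x * y' + y * x', ?_⟩
    simp only [map_add, map_mul, map_ofNat]
    linear_combination (algebraMap ℚ_[5] (PadicAlgCl 5) y * algebraMap ℚ_[5] (PadicAlgCl 5) y') * hs

/-- The norms of `x` and `y √5` lie in different cosets of `5^ℤ`. -/
theorem norm_ne_norm_mul_sqrt {x y : ℚ_[5]} (hy : y ≠ 0) :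
    ‖algebraMap ℚ_[5] (PadicAlgCl 5) x‖ ≠ ‖algebraMap ℚ_[5] (PadicAlgCl 5) y * s‖ := by
  intro h
  have hs5 := norm_sq_sqrt_five norm_five hs
  have h2 : ‖x‖ ^ 2 = ‖y‖ ^ 2 * (1 / 5) := by
    rw [← hs5, ← mul_pow, ← norm_algebraMap_padic x, h, norm_mul, norm_algebraMap_padic]
  have hx : x ≠ 0 := by
    rintro rfl
    rw [norm_zero] at h2
    have := norm_pos_iff.2 hy
    nlinarith
  rw [Padic.norm_eq_zpow_neg_valuation hx, Padic.norm_eq_zpow_neg_valuation hy, ← zpow_natCast,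
    ← zpow_natCast, ← zpow_mul, ← zpow_mul, one_div, ← zpow_neg_one] at h2
  push_cast at h2
  rw [← zpow_add₀ (by norm_num), zpow_right_inj₀ (by norm_num) (by norm_num)] at h2
  lia

theorem norm_add_mul_sqrt (x y : ℚ_[5]) :
    ‖algebraMap ℚ_[5] (PadicAlgCl 5) x + algebraMap ℚ_[5] (PadicAlgCl 5) y * s‖ =
      max ‖x‖ ‖algebraMap ℚ_[5] (PadicAlgCl 5) y * s‖ := by
  rcases eq_or_ne y 0 with rfl | hy
  · simp
  · rw [IsUltrametricDist.norm_add_eq_max_of_norm_ne_norm (norm_ne_norm_mul_sqrt hs hy),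
      norm_algebraMap_padic]

theorem norm_mul_sqrt_lt_one {y : ℚ_[5]} (h : ‖algebraMap ℚ_[5] (PadicAlgCl 5) y * s‖ ≤ 1) :
    ‖algebraMap ℚ_[5] (PadicAlgCl 5) y * s‖ < 1 := by
  rcases eq_or_ne y 0 with rfl | hy
  · simp
  refine lt_of_le_of_ne h fun h1 ↦ norm_ne_norm_mul_sqrt hs (x := 1) hy ?_
  rw [h1, map_one, norm_one]

/-- The residue field of `ℚ₅(√5)` is `𝔽₅`. -/
theorem exists_int_norm_sub_lt {c : PadicAlgCl 5}
    (hc : c ∈ IntermediateField.adjoin ℚ_[5] {s}) (h1 : ‖c‖ ≤ 1) :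
    ∃ z : ℤ, ‖c - z‖ < 1 := by
  obtain ⟨x, y, rfl⟩ := exists_eq_add_mul_of_mem_adjoin hs hc
  rw [norm_add_mul_sqrt hs, max_le_iff] at h1
  obtain ⟨x, rfl⟩ : ∃ x' : ℤ_[5], (x' : ℚ_[5]) = x := ⟨⟨x, h1.1⟩, rfl⟩
  obtain ⟨m, -, hm⟩ := PadicInt.exists_mem_range x
  refine ⟨m, ?_⟩
  rw [IsLocalRing.mem_maximalIdeal, PadicInt.mem_nonunits, PadicInt.norm_def] at hm
  rw [add_sub_right_comm]
  refine norm_add_lt_of_lt ?_ (norm_mul_sqrt_lt_one hs h1.2)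
  rw [Int.cast_natCast, ← map_natCast (algebraMap ℚ_[5] (PadicAlgCl 5)), ← map_sub,
    norm_algebraMap_padic]
  rwa [PadicInt.coe_sub, PadicInt.coe_natCast] at hm

theorem frobenius_res_of_mem_adjoin {c : integers}
    (hc : (c : PadicAlgCl 5) ∈ IntermediateField.adjoin ℚ_[5] {s}) :
    frobenius ResidueF 5 (res c) = res c := by
  obtain ⟨z, hz⟩ := exists_int_norm_sub_lt hs hc (mem_integers.1 c.2)
  have : res c = res (z : integers) := res_eq_iff.2 (by simpa using hz)
  rw [this, map_intCast, map_intCast]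

end Sqrt

/-! ### Degrees of periodic points -/

/-- A nonzero polynomial over `𝔽₅` vanishing at `α` has the Frobenius orbit of `α` among its
roots. -/
theorem minimalPeriod_le_natDegree {k : Type*} [Field k] [CharP k 5] {q : k[X]} (hq : q ≠ 0)
    (hfrob : q.map (frobenius k 5) = q) {α : k} (hα : q.eval α = 0) :
    Function.minimalPeriod (frobenius k 5) α ≤ q.natDegree := by
  classical
  have hroot (i : ℕ) : q.eval ((frobenius k 5)^[i] α) = 0 := by
    induction i with
    | zero => exact hα
    | succ i ih =>
      rw [Function.iterate_succ_apply', ← hfrob, eval_map, eval₂_at_apply, ih, map_zero]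
  have hinj : Set.InjOn (fun i ↦ (frobenius k 5)^[i] α)
      (Finset.range (Function.minimalPeriod (frobenius k 5) α)) := fun i hi j hj h ↦
    Function.iterate_injOn_Iio_minimalPeriod (by simpa using hi) (by simpa using hj) h
  calc _ = ((Finset.range (Function.minimalPeriod (frobenius k 5) α)).image
        fun i ↦ (frobenius k 5)^[i] α).card := by
        rw [Finset.card_image_of_injOn hinj, Finset.card_range]
    _ ≤ q.roots.toFinset.card := by
        refine Finset.card_le_card fun β hβ ↦ ?_
        obtain ⟨i, -, rfl⟩ := Finset.mem_image.1 hβ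
        rw [Multiset.mem_toFinset, mem_roots hq]
        exact hroot i
    _ ≤ q.roots.card := Multiset.toFinset_card_le _
    _ ≤ q.natDegree := card_roots' q

theorem exists_map_subtype_eq {f : (PadicAlgCl 5)[X]} (hf : ∀ i, ‖f.coeff i‖ ≤ 1) :
    ∃ g : integers[X], g.map integers.subtype = f :=
  (mem_lifts f).1 ((lifts_iff_coeff_lifts f).2 fun i ↦ ⟨⟨_, mem_integers.2 (hf i)⟩, rfl⟩)

theorem exists_conj_of_aeval_minpoly {K : Type*} [Field K] [Algebra K (PadicAlgCl 5)]
    [Normal K (PadicAlgCl 5)] {a b : PadicAlgCl 5} (h : aeval b (minpoly K a) = 0) :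
    ∃ σ : Gal(PadicAlgCl 5/K), σ a = b :=
  minpoly.exists_algEquiv_of_root' (Normal.isIntegral inferInstance a).isAlgebraic h

/-- The Galois group of `ℚ̄₅` over `ℚ₅` acts on the integers. -/
theorem algEquiv_mem_integers (σ : Gal(PadicAlgCl 5/ℚ_[5])) {x : PadicAlgCl 5}
    (hx : x ∈ integers) : σ x ∈ integers := by
  rwa [mem_integers, norm_algEquiv, ← mem_integers]

/-- The residue class of a conjugate of `x` is in the Frobenius orbit of the class of `x`. -/
theorem exists_res_conj_eq (σ : Gal(PadicAlgCl 5/ℚ_[5])) {x y : integers}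
    (hxy : σ x = y) (hx : 1 ≤ Function.minimalPeriod (frobenius ResidueF 5) (res x)) :
    ∃ i < Function.minimalPeriod (frobenius ResidueF 5) (res x),
      res y = (frobenius ResidueF 5)^[i] (res x) := by
  set n := Function.minimalPeriod (frobenius ResidueF 5) (res x) with hn
  set H : ResidueF[X] := ∏ i ∈ Finset.range n, (X - C ((frobenius ResidueF 5)^[i] (res x))) with hH
  have hfrob : H.map (frobenius ResidueF 5) = H := by
    obtain ⟨m, hm⟩ := Nat.exists_eq_add_of_le' hx
    have hper : (frobenius ResidueF 5)^[m + 1] (res x) = res x := by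
      rw [← hm, hn]
      exact Function.iterate_minimalPeriod
    simp only [hH, Polynomial.map_prod, Polynomial.map_sub, map_X, map_C,
      ← Function.iterate_succ_apply' (frobenius ResidueF 5)]
    rw [hm, Finset.prod_range_succ, Finset.prod_range_succ', hper]
    rfl
  obtain ⟨P, hP⟩ : ∃ P : ℤ[X], P.map (Int.castRingHom ResidueF) = H := by
    refine (mem_lifts H).1 ((lifts_iff_coeff_lifts H).2 fun i ↦ ?_)
    have h1 : H.coeff i ^ 5 = H.coeff i := by
      conv_rhs => rw [← hfrob, coeff_map, frobenius_def]
    rw [← Subfield.mem_bot_iff_pow_eq_self, mem_bot_iff_intCast 5] at h1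
    obtain ⟨z, hz⟩ := h1
    exact ⟨z, by simpa using hz⟩
  have hx0 : ‖aeval (x : PadicAlgCl 5) P‖ < 1 := by
    rw [← coe_eval_map_int, ← res_eq_zero_iff, res_eval_map_int, hP, hH, eval_prod]
    exact Finset.prod_eq_zero (Finset.mem_range.2 hx) (by simp)
  have hy0 : ‖aeval (y : PadicAlgCl 5) P‖ < 1 := by
    have : aeval (σ x) P = σ (aeval (x : PadicAlgCl 5) P) := by
      have h := hom_eval₂ P (algebraMap ℤ (PadicAlgCl 5)) (σ : PadicAlgCl 5 →+* PadicAlgCl 5) x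
      rw [RingHom.ext_int ((σ : PadicAlgCl 5 →+* PadicAlgCl 5).comp (algebraMap ℤ (PadicAlgCl 5)))
        (algebraMap ℤ (PadicAlgCl 5))] at h
      exact h.symm
    rw [← hxy, this, norm_algEquiv]
    exact hx0
  rw [← coe_eval_map_int, ← res_eq_zero_iff, res_eval_map_int, hP, hH, eval_prod,
    Finset.prod_eq_zero_iff] at hy0
  obtain ⟨i, hi, h⟩ := hy0
  refine ⟨i, Finset.mem_range.1 hi, ?_⟩
  rwa [eval_sub, eval_X, eval_C, sub_eq_zero] at h

theorem HasPeriod.map {A B F : Type*} [CommRing A] [CommRing B] [FunLike F A B] [RingHomClass F A B]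
    (φ : F) {n : ℕ} {a : A} (ha : HasPeriod A n a) : HasPeriod B n (φ a) := by
  obtain ⟨c, h0, h1, hc⟩ := ha
  exact ⟨fun i ↦ φ (c i), by simp [h0], by simp [h1], fun i hi ↦ by
    rw [← map_gPoly, hc i hi, map_zero]⟩

theorem res_conj_ne_two (σ : Gal(PadicAlgCl 5/ℚ_[5])) {x y : integers} (hxy : σ x = y)
    (hx : res x ≠ 2) : res y ≠ 2 := by
  rw [Ne, res_eq_two_iff] at hx ⊢
  rwa [← hxy, ← map_ofNat σ 2, ← map_sub, norm_algEquiv]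

/-- The conjugates of a periodic point outside the class of `2` are determined by their residue
classes, which lie in one Frobenius orbit. -/
theorem natDegree_minpoly_le {m : ℕ} (hm : 1 ≤ m) {a : integers}
    (ha : HasPeriod (PadicAlgCl 5) m a) (ha2 : res a ≠ 2) :
    (minpoly ℚ_[5] (a : PadicAlgCl 5)).natDegree ≤
      Function.minimalPeriod (frobenius ResidueF 5) (res a) := by
  classical
  have hint : IsIntegral ℚ_[5] (a : PadicAlgCl 5) := Algebra.IsIntegral.isIntegral _
  set n := Function.minimalPeriod (frobenius ResidueF 5) (res a) with hn
  have hn1 : 1 ≤ n := minimalPeriod_pos_of_hasPeriod hm ha ha2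
  set T := ((minpoly ℚ_[5] (a : PadicAlgCl 5)).aroots (PadicAlgCl 5)).toFinset with hT
  have hTcard : T.card = (minpoly ℚ_[5] (a : PadicAlgCl 5)).natDegree := by
    rw [hT, Multiset.toFinset_card_of_nodup
      (nodup_aroots_iff_of_splits (minpoly.ne_zero hint) (IsAlgClosed.splits _) |>.2
        (minpoly.irreducible hint).separable),
      ← (IsAlgClosed.splits _).natDegree_eq_card_roots, natDegree_map]
  have hconj {b : PadicAlgCl 5} (hb : b ∈ T) : ∃ b' : integers, (b' : PadicAlgCl 5) = b ∧
      HasPeriod (PadicAlgCl 5) m b ∧ res b' ≠ 2 ∧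
      ∃ i < n, res b' = (frobenius ResidueF 5)^[i] (res a) := by
    obtain ⟨σ, rfl⟩ := exists_conj_of_aeval_minpoly (mem_aroots.1 (Multiset.mem_toFinset.1 hb)).2
    exact ⟨⟨_, algEquiv_mem_integers σ a.2⟩, rfl, ha.map σ, res_conj_ne_two σ rfl ha2,
      exists_res_conj_eq σ rfl hn1⟩
  choose! lift hlift using fun b ↦ hconj (b := b)
  rw [← hTcard, ← Finset.card_range n, ← Finset.card_image_of_injOn (s := T) (f := fun b ↦
    res (lift b))]
  · refine (Finset.card_le_card fun β hβ ↦ ?_).trans (Finset.card_image_le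
      (f := fun i ↦ (frobenius ResidueF 5)^[i] (res a)))
    obtain ⟨b, hb, rfl⟩ := Finset.mem_image.1 hβ
    obtain ⟨-, -, -, i, hi, h⟩ := hlift b hb
    exact Finset.mem_image.2 ⟨i, Finset.mem_range.2 hi, h.symm⟩
  · intro b hb c hc h
    obtain ⟨hb1, hb2, hb3, -⟩ := hlift b hb
    obtain ⟨hc1, hc2, -⟩ := hlift c hc
    have hb : HasPeriod (PadicAlgCl 5) m (lift b) := by rwa [hb1]
    have hc : HasPeriod (PadicAlgCl 5) m (lift c) := by rwa [hc1]
    rw [← hb1, ← hc1, HasPeriod.eq_of_res_eq hm hm hb hc hb3 h]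

section Sqrt

variable {s : PadicAlgCl 5} (hs : s ^ 2 = 5)
include hs

/-- The powers `1, a, …, aⁿ⁻¹` are linearly independent modulo the maximal ideal, over the residue
field `𝔽₅` of `ℚ₅(√5)`, if the residue class of `a` has minimal period `n` under Frobenius. -/
theorem one_le_norm_eval {a : integers} {f : (PadicAlgCl 5)[X]} (hf : ∀ i, ‖f.coeff i‖ ≤ 1)
    (hfs : ∀ i, f.coeff i ∈ IntermediateField.adjoin ℚ_[5] {s}) {j : ℕ} (hj : ‖f.coeff j‖ = 1)
    (hdeg : f.natDegree < Function.minimalPeriod (frobenius ResidueF 5) (res a)) :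
    1 ≤ ‖f.eval (a : PadicAlgCl 5)‖ := by
  obtain ⟨g, rfl⟩ := exists_map_subtype_eq hf
  by_contra! hlt
  have heval : (g.map res).eval (res a) = 0 := by
    rw [eval_map, eval₂_at_apply, res_eq_zero_iff]
    have h1 := eval₂_at_apply (p := g) integers.subtype a
    rw [eval_map] at hlt
    exact (congrArg norm h1).symm.trans_lt hlt
  have hne : g.map res ≠ 0 := fun h ↦ by
    have h1 := congrArg (fun p ↦ p.coeff j) h
    simp only [coeff_map, coeff_zero] at h1 hj
    rw [res_eq_zero_iff] at h1
    exact h1.ne hj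
  have hfrob : (g.map res).map (frobenius ResidueF 5) = g.map res := by
    ext i
    rw [coeff_map, coeff_map]
    refine frobenius_res_of_mem_adjoin hs ?_
    have := hfs i
    rwa [coeff_map] at this
  have h1 := minimalPeriod_le_natDegree hne hfrob heval
  rw [natDegree_map_eq_of_injective (Subtype.val_injective : Function.Injective integers.subtype)]
    at hdeg
  exact absurd (h1.trans natDegree_map_le) (not_le.2 hdeg)

omit hs in
theorem norm_coeff_minpoly_le {K : Type*} [Field K] [Algebra K (PadicAlgCl 5)]
    [Algebra ℚ_[5] K] [IsScalarTower ℚ_[5] K (PadicAlgCl 5)]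
    {a : PadicAlgCl 5} (ha : ‖a‖ ≤ 1) (i : ℕ) :
    ‖((minpoly K a).map (algebraMap K (PadicAlgCl 5))).coeff i‖ ≤ 1 := by
  have : Algebra.IsAlgebraic K (PadicAlgCl 5) := Algebra.IsAlgebraic.tower_top (K := ℚ_[5]) K
  have : Normal K (PadicAlgCl 5) := Normal.tower_top_of_normal ℚ_[5] K _
  have hint : IsIntegral K a := Algebra.IsIntegral.isIntegral a
  have hmem : (minpoly K a).map (algebraMap K (PadicAlgCl 5)) ∈ lifts integers.subtype := by
    rw [((IsAlgClosed.splits _).eq_prod_roots_of_monic ((minpoly.monic hint).map _))]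
    refine Submonoid.multiset_prod_mem _ _ fun f hf ↦ ?_
    obtain ⟨b, hb, rfl⟩ := Multiset.mem_map.1 hf
    obtain ⟨σ, rfl⟩ := exists_conj_of_aeval_minpoly (mem_aroots.1 hb).2
    have hσ : σ a ∈ integers :=
      algEquiv_mem_integers (σ.restrictScalars ℚ_[5]) (mem_integers.2 ha)
    exact ⟨X - C ⟨σ a, hσ⟩, by simp⟩
  obtain ⟨z, hz⟩ := (lifts_iff_coeff_lifts _).1 hmem i
  rw [← hz]
  exact mem_integers.1 z.2

theorem le_natDegree_minpoly (a : integers) :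
    Function.minimalPeriod (frobenius ResidueF 5) (res a) ≤
      (minpoly (IntermediateField.adjoin ℚ_[5] {s}) (a : PadicAlgCl 5)).natDegree := by
  by_contra! hlt
  have hint : IsIntegral (IntermediateField.adjoin ℚ_[5] {s}) (a : PadicAlgCl 5) :=
    (Algebra.IsIntegral.isIntegral (R := ℚ_[5]) (a : PadicAlgCl 5)).tower_top
  have h1 := one_le_norm_eval hs (a := a)
    (norm_coeff_minpoly_le (K := IntermediateField.adjoin ℚ_[5] {s}) (mem_integers.1 a.2))
    (fun i ↦ by rw [coeff_map]; exact SetLike.coe_mem _)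
    (j := (minpoly (IntermediateField.adjoin ℚ_[5] {s}) (a : PadicAlgCl 5)).natDegree)
    (by rw [coeff_map, coeff_natDegree, (minpoly.monic hint).leadingCoeff, map_one, norm_one])
    (by rwa [natDegree_map])
  rw [eval_map_algebraMap, minpoly.aeval, norm_zero] at h1
  linarith

/-- A periodic point outside the class of `2` has the same minimal polynomial over `ℚ₅` and over
`ℚ₅(√5)`, and its degree is the minimal period of the residue class. -/
theorem minpoly_eq_and_natDegree {m : ℕ} (hm : 1 ≤ m) {a : integers}
    (ha : HasPeriod (PadicAlgCl 5) m a) (ha2 : res a ≠ 2) :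
    minpoly (IntermediateField.adjoin ℚ_[5] {s}) (a : PadicAlgCl 5) =
        (minpoly ℚ_[5] (a : PadicAlgCl 5)).map (algebraMap _ _) ∧
      (minpoly ℚ_[5] (a : PadicAlgCl 5)).natDegree =
        Function.minimalPeriod (frobenius ResidueF 5) (res a) := by
  have hint : IsIntegral ℚ_[5] (a : PadicAlgCl 5) := Algebra.IsIntegral.isIntegral _
  have hint' : IsIntegral (IntermediateField.adjoin ℚ_[5] {s}) (a : PadicAlgCl 5) := hint.tower_top
  have h1 := natDegree_minpoly_le hm ha ha2
  have h2 := le_natDegree_minpoly hs a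
  have hdvd := minpoly.dvd_map_of_isScalarTower ℚ_[5] (IntermediateField.adjoin ℚ_[5] {s})
    (a : PadicAlgCl 5)
  have hmon := (minpoly.monic hint).map (algebraMap ℚ_[5] (IntermediateField.adjoin ℚ_[5] {s}))
  have h3 := natDegree_le_of_dvd hdvd hmon.ne_zero
  rw [natDegree_map] at h3
  refine ⟨(eq_of_monic_of_dvd_of_natDegree_le (minpoly.monic hint') hmon hdvd ?_).symm, by lia⟩
  rw [natDegree_map]
  lia

end Sqrt

/-! ### Integral elements -/

theorem algebraMap_padicInt (z : ℤ_[5]) :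
    algebraMap ℤ_[5] (PadicAlgCl 5) z = algebraMap ℚ_[5] (PadicAlgCl 5) z :=
  IsScalarTower.algebraMap_apply ℤ_[5] ℚ_[5] (PadicAlgCl 5) z

theorem norm_algebraMap_padicInt (z : ℤ_[5]) : ‖algebraMap ℤ_[5] (PadicAlgCl 5) z‖ ≤ 1 := by
  rw [algebraMap_padicInt, norm_algebraMap_padic]
  exact z.2

theorem isIntegral_padicInt_iff {x : PadicAlgCl 5} : IsIntegral ℤ_[5] x ↔ ‖x‖ ≤ 1 := by
  constructor
  · rintro ⟨P, hP, h0⟩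
    let φ : ℤ_[5] →+* integers := (algebraMap ℤ_[5] (PadicAlgCl 5)).codRestrict integers.toSubring
      fun z ↦ mem_integers.2 (norm_algebraMap_padicInt z)
    have hx : IsIntegral integers x := by
      refine ⟨P.map φ, hP.map φ, ?_⟩
      rw [eval₂_map]
      exact h0
    obtain ⟨y, rfl⟩ := IsIntegrallyClosed.isIntegral_iff.1 hx
    exact mem_integers.1 y.2
  · intro h
    have hint : IsIntegral ℚ_[5] x := Algebra.IsIntegral.isIntegral x
    have h1 : spectralValue (minpoly ℚ_[5] x) ≤ 1 := h
    rw [spectralValue_le_one_iff (minpoly.monic hint)] at h1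
    obtain ⟨P, hP, -, hPm⟩ := lifts_and_natDegree_eq_and_monic
      ((lifts_iff_coeff_lifts (f := algebraMap ℤ_[5] ℚ_[5]) (minpoly ℚ_[5] x)).2
        fun i ↦ ⟨⟨_, h1 i⟩, rfl⟩) (minpoly.monic hint)
    refine ⟨P, hPm, ?_⟩
    rw [IsScalarTower.algebraMap_eq ℤ_[5] ℚ_[5] (PadicAlgCl 5), ← eval₂_map, hP]
    exact minpoly.aeval _ x

theorem isIntegral_coe_iff {E : IntermediateField ℚ_[5] (PadicAlgCl 5)} {x : E} :
    IsIntegral ℤ_[5] x ↔ ‖(x : PadicAlgCl 5)‖ ≤ 1 := by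
  rw [← isIntegral_padicInt_iff]
  exact (isIntegral_algHom_iff (E.val.restrictScalars ℤ_[5]) Subtype.val_injective).symm

/-! ### The unramified fields generated by periodic points -/

section Sqrt

variable {s : PadicAlgCl 5} (hs : s ^ 2 = 5)
include hs

/-- The ring of integers of `ℚ₅(a)` is `ℤ₅[a]`, since the powers of `a` that span `ℚ₅(a)` are
linearly independent modulo the maximal ideal. -/
theorem exists_aeval_eq_of_norm_le_one {m : ℕ} (hm : 1 ≤ m) {a : integers}
    (ha : HasPeriod (PadicAlgCl 5) m a) (ha2 : res a ≠ 2) {x : PadicAlgCl 5}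
    (hx : x ∈ IntermediateField.adjoin ℚ_[5] {(a : PadicAlgCl 5)}) (hx1 : ‖x‖ ≤ 1) :
    ∃ P : ℤ_[5][X], aeval (a : PadicAlgCl 5) P = x := by
  have hint : IsIntegral ℚ_[5] (a : PadicAlgCl 5) := Algebra.IsIntegral.isIntegral _
  rw [← IntermediateField.mem_toSubalgebra,
    IntermediateField.adjoin_simple_toSubalgebra_of_isAlgebraic hint.isAlgebraic,
    Algebra.adjoin_singleton_eq_range_aeval] at hx
  obtain ⟨p, rfl⟩ := hx
  change ‖aeval (a : PadicAlgCl 5) p‖ ≤ 1 at hx1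
  change ∃ P : ℤ_[5][X], aeval (a : PadicAlgCl 5) P = aeval (a : PadicAlgCl 5) p
  have hmod : aeval (a : PadicAlgCl 5) (p %ₘ minpoly ℚ_[5] (a : PadicAlgCl 5)) =
      aeval (a : PadicAlgCl 5) p := by
    have := congrArg (aeval (a : PadicAlgCl 5))
      (modByMonic_add_div p (minpoly ℚ_[5] (a : PadicAlgCl 5)))
    rwa [map_add, map_mul, minpoly.aeval, zero_mul, add_zero] at this
  have hdeg : (p %ₘ minpoly ℚ_[5] (a : PadicAlgCl 5)).natDegree <
      Function.minimalPeriod (frobenius ResidueF 5) (res a) := by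
    rw [← (minpoly_eq_and_natDegree hs hm ha ha2).2]
    exact natDegree_modByMonic_lt p (minpoly.monic hint) (minpoly.ne_one _ _)
  rw [← hmod] at hx1 ⊢
  generalize p %ₘ minpoly ℚ_[5] (a : PadicAlgCl 5) = r at hdeg hx1
  suffices hr : ∀ i, ‖r.coeff i‖ ≤ 1 by
    obtain ⟨P, rfl⟩ := (mem_lifts r).1 ((lifts_iff_coeff_lifts (f := algebraMap ℤ_[5] ℚ_[5]) r).2
        fun i ↦ ⟨⟨_, hr i⟩, rfl⟩)
    exact ⟨P, (aeval_map_algebraMap _ _ _).symm⟩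
  by_contra! hcon
  -- normalize the largest coefficient to `1`
  obtain ⟨j, -, hj⟩ := Finset.exists_max_image (Finset.range (r.natDegree + 1))
    (fun i ↦ ‖r.coeff i‖) ⟨0, by simp⟩
  have hmax (i : ℕ) : ‖r.coeff i‖ ≤ ‖r.coeff j‖ := by
    by_cases hi : i < r.natDegree + 1
    · exact hj i (Finset.mem_range.2 hi)
    · rw [coeff_eq_zero_of_natDegree_lt (by lia), norm_zero]
      exact norm_nonneg _
  obtain ⟨i, hi⟩ := hcon
  have hj1 : 1 < ‖r.coeff j‖ := hi.trans_le (hmax i)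
  have hj0 : r.coeff j ≠ 0 := norm_pos_iff.1 (one_pos.trans hj1)
  have h1 := one_le_norm_eval hs (a := a)
    (f := (C (r.coeff j)⁻¹ * r).map (algebraMap ℚ_[5] (PadicAlgCl 5))) (fun i ↦ by
      rw [coeff_map, norm_algebraMap_padic, coeff_C_mul, norm_mul, norm_inv,
        inv_mul_le_one₀ (one_pos.trans hj1)]
      exact hmax i) (fun i ↦ by rw [coeff_map]; exact IntermediateField.algebraMap_mem _ _)
    (j := j) (by
      rw [coeff_map, norm_algebraMap_padic, coeff_C_mul, inv_mul_cancel₀ hj0, norm_one])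
    (by rwa [natDegree_map, natDegree_C_mul (inv_ne_zero hj0)])
  rw [eval_map_algebraMap, map_mul, aeval_C, norm_mul, norm_algebraMap_padic, norm_inv] at h1
  have h2 : ‖r.coeff j‖⁻¹ * ‖aeval (a : PadicAlgCl 5) r‖ < 1 :=
    calc _ ≤ ‖r.coeff j‖⁻¹ * 1 := by gcongr
      _ < 1 := by rw [mul_one]; exact inv_lt_one_of_one_lt₀ hj1
  exact absurd h1 (not_le.2 h2)

omit hs in
theorem norm_aeval_derivative_Rdiag {m : ℕ} (hm : 1 ≤ m) {a : integers}
    (ha : HasPeriod (PadicAlgCl 5) m a) (ha2 : res a ≠ 2) :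
    ‖aeval (a : PadicAlgCl 5) (derivative (Rdiag m))‖ = 1 := by
  have hpow : res a ^ 5 ^ m = res a := by
    rw [← map_pow, res_eq_iff]
    refine ha.norm_pow_sub_lt norm_five hm ?_
    by_contra! h
    exact ha2 (res_eq_two_iff.2 h)
  have h := eval_derivative_Rdiag_map hm hpow ha2
  rw [derivative_map, ← res_eval_map_int, Ne, res_eq_zero_iff, not_lt, coe_eval_map_int] at h
  refine le_antisymm ?_ h
  rw [← coe_eval_map_int]
  exact mem_integers.1 (SetLike.coe_mem _)

/-- A periodic point `a` outside the class of `2` generates an unramified extension: the ring of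
integers is `ℤ₅[a]`, and `a` is a simple root of the reduction of `Rₘ`. -/
theorem isUnramifiedExt_adjoin {m : ℕ} (hm : 1 ≤ m) {a : integers}
    (ha : HasPeriod (PadicAlgCl 5) m a) (ha2 : res a ≠ 2) :
    IsUnramifiedExt (IntermediateField.adjoin ℚ_[5] {(a : PadicAlgCl 5)}) := by
  have hint : IsIntegral ℚ_[5] (a : PadicAlgCl 5) := Algebra.IsIntegral.isIntegral _
  refine ⟨IntermediateField.adjoin.finiteDimensional hint, ?_⟩
  set E := IntermediateField.adjoin ℚ_[5] {(a : PadicAlgCl 5)} with hE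
  let B := integralClosure ℤ_[5] E
  let ι : B →ₐ[ℤ_[5]] PadicAlgCl 5 := (E.val.restrictScalars ℤ_[5]).comp B.val
  have hι : Function.Injective ι := Subtype.val_injective.comp Subtype.val_injective
  have hmemB {x : PadicAlgCl 5} (hx : x ∈ E) (h1 : ‖x‖ ≤ 1) : ∃ y : B, ι y = x :=
    ⟨⟨⟨x, hx⟩, isIntegral_coe_iff.2 h1⟩, rfl⟩
  have hιnorm (y : B) : ‖ι y‖ ≤ 1 := isIntegral_coe_iff.1 y.2
  have hιmem (y : B) : ι y ∈ E := y.1.2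
  obtain ⟨b, hb⟩ := hmemB (IntermediateField.mem_adjoin_simple_self ℚ_[5] _) (mem_integers.1 a.2)
  have hadj : Algebra.adjoin ℤ_[5] {b} = ⊤ := by
    refine Algebra.eq_top_iff.2 fun y ↦ ?_
    obtain ⟨P, hP⟩ := exists_aeval_eq_of_norm_le_one hs hm ha ha2 (hιmem y) (hιnorm y)
    rw [← hb, aeval_algHom_apply] at hP
    rw [← hι hP]
    exact aeval_mem_adjoin_singleton _ _
  set P : ℤ_[5][X] := (Rdiag m).map (Int.castRingHom ℤ_[5]) with hP
  have hmap (Q : ℤ[X]) : ι (aeval b (Q.map (Int.castRingHom ℤ_[5]))) =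
      aeval (a : PadicAlgCl 5) Q := by
    rw [← aeval_algHom_apply, hb, aeval_def, aeval_def, eval₂_map]
    congr 1
  have hroot : aeval b P = 0 := by
    apply hι
    rw [hP, hmap, map_zero]
    exact (aeval_Rdiag_eq_zero_iff hm _).2 ha
  have hunit : IsUnit (aeval b (derivative P)) := by
    have h1 := norm_aeval_derivative_Rdiag hm ha ha2
    have h2 : ι (aeval b (derivative P)) = aeval (a : PadicAlgCl 5) (derivative (Rdiag m)) := by
      rw [hP, derivative_map, hmap]
    obtain ⟨c, hc⟩ := hmemB (x := (ι (aeval b (derivative P)))⁻¹) (inv_mem (hιmem _))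
      (by rw [norm_inv, h2, h1, inv_one])
    refine IsUnit.of_mul_eq_one c (hι ?_)
    rw [map_mul, hc, map_one, mul_inv_cancel₀]
    rw [h2]
    exact norm_pos_iff.1 (h1 ▸ one_pos)
  have hft : Algebra.FiniteType ℤ_[5] B := ⟨⟨{b}, by rw [Finset.coe_singleton, hadj]⟩⟩
  have hfu : Algebra.FormallyUnramified ℤ_[5] B := by
    rw [Algebra.FormallyUnramified.iff_comp_injective]
    intro D _ _ I hI f₁ f₂ hf
    refine AlgHom.ext_of_adjoin_eq_top hadj ?_
    intro y hy
    rw [Set.mem_singleton_iff.1 hy]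
    have hmem : f₁ b - f₂ b ∈ I := by
      rw [← Ideal.Quotient.mk_eq_mk_iff_sub_mem]
      exact DFunLike.congr_fun hf b
    have hsq : (f₁ b - f₂ b) ^ 2 = 0 := by
      have := Ideal.pow_mem_pow hmem 2
      rwa [hI] at this
    have h1 := aeval_add_of_sq_eq_zero P (f₂ b) (f₁ b - f₂ b) hsq
    rw [add_sub_cancel, aeval_algHom_apply, aeval_algHom_apply, aeval_algHom_apply, hroot, map_zero,
      map_zero, zero_add] at h1
    exact sub_eq_zero.1 ((hunit.map f₂).mul_right_eq_zero.1 h1.symm)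
  exact ⟨hfu, hft⟩

theorem mem_maxUnramified_of_hasPeriod {m : ℕ} (hm : 1 ≤ m) {a : PadicAlgCl 5}
    (ha : HasPeriod (PadicAlgCl 5) m a) (ha2 : 1 ≤ ‖a - 2‖) : a ∈ maxUnramified := by
  lift a to integers using mem_integers.2 (ha.norm_le_one hm)
  exact le_sSup (show _ ∈ {E | IsUnramifiedExt E} from
    isUnramifiedExt_adjoin hs hm ha fun h ↦ not_lt.2 ha2 (res_eq_two_iff.1 h))
    (IntermediateField.mem_adjoin_simple_self ℚ_[5] _)

end Sqrt

/-! ### Inertia -/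

/-- The ideal `‖z‖ ≤ ρ` of the ring of integers of `ℚ̄₅`. -/
noncomputable def normIdeal (ρ : ℝ) (hρ : 0 ≤ ρ) :
    Ideal (integralClosure ℤ_[5] (PadicAlgCl 5)) where
  carrier := {z | ‖(z : PadicAlgCl 5)‖ ≤ ρ}
  add_mem' ha hb := norm_add_le_of_le' ha hb
  zero_mem' := by simpa using hρ
  smul_mem' c z hz := by
    have hc : ‖(c : PadicAlgCl 5)‖ ≤ 1 := isIntegral_padicInt_iff.1 c.2
    change ‖(c : PadicAlgCl 5) * z‖ ≤ ρ
    rw [norm_mul]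
    exact (mul_le_of_le_one_left (norm_nonneg _) hc).trans hz

theorem mem_normIdeal {ρ : ℝ} {hρ : 0 ≤ ρ} {z : integralClosure ℤ_[5] (PadicAlgCl 5)} :
    z ∈ normIdeal ρ hρ ↔ ‖(z : PadicAlgCl 5)‖ ≤ ρ := Iff.rfl

theorem normIdeal_pow_le {ρ : ℝ} (hρ : 0 ≤ ρ) (n : ℕ) :
    normIdeal ρ hρ ^ n ≤ normIdeal (ρ ^ n) (pow_nonneg hρ n) := by
  induction n with
  | zero =>
    intro z _
    rw [mem_normIdeal, pow_zero]
    exact isIntegral_padicInt_iff.1 z.2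
  | succ n ih =>
    rw [pow_succ, Ideal.mul_le]
    intro x hx y hy
    rw [mem_normIdeal, MulMemClass.coe_mul, norm_mul, pow_succ]
    exact mul_le_mul (ih hx) hy (norm_nonneg _) (pow_nonneg hρ n)

theorem iInf_normIdeal_pow {ρ : ℝ} (hρ : 0 ≤ ρ) (hρ1 : ρ < 1) :
    ⨅ n, normIdeal ρ hρ ^ n = ⊥ := by
  rw [eq_bot_iff]
  intro z hz
  rw [Ideal.mem_iInf] at hz
  rw [Ideal.mem_bot]
  refine Subtype.ext (norm_le_zero_iff.1 ?_)
  exact ge_of_tendsto' (tendsto_pow_atTop_nhds_zero_of_lt_one hρ hρ1)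
    fun n ↦ normIdeal_pow_le hρ n (hz n)

theorem exists_lt_one_forall_le {ι : Type*} (S : Finset ι) {f : ι → ℝ} (h : ∀ x ∈ S, f x < 1) :
    ∃ ρ, 0 ≤ ρ ∧ ρ < 1 ∧ ∀ x ∈ S, f x ≤ ρ := by
  classical
  induction S using Finset.induction with
  | empty => exact ⟨0, le_rfl, one_pos, by simp⟩
  | insert a S _ ih =>
    obtain ⟨ρ, h0, h1, hρ⟩ := ih fun x hx ↦ h x (Finset.mem_insert_of_mem hx)
    refine ⟨max ρ (f a), h0.trans (le_max_left _ _),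
      max_lt h1 (h a (Finset.mem_insert_self a S)), fun x hx ↦ ?_⟩
    rcases Finset.mem_insert.1 hx with rfl | hx
    · exact le_max_right _ _
    · exact (hρ x hx).trans (le_max_left _ _)

/-- An automorphism that acts trivially on the residue field fixes the unramified extensions: on the
ring of integers, which is finitely generated, it is congruent to the identity modulo
the ideal `‖z‖ ≤ ρ` for some `ρ < 1`, and the powers of this ideal intersect in zero. -/
theorem IsUnramifiedExt.apply_eq {E : IntermediateField ℚ_[5] (PadicAlgCl 5)}
    (hE : IsUnramifiedExt E) {σ : Gal(PadicAlgCl 5/ℚ_[5])}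
    (hσ : ∀ x : PadicAlgCl 5, ‖x‖ ≤ 1 → ‖σ x - x‖ < 1) {x : PadicAlgCl 5} (hx : x ∈ E) :
    σ x = x := by
  have := hE.2.formallyUnramified
  obtain ⟨S, hS⟩ := hE.2.finiteType.1
  let A := integralClosure ℤ_[5] E
  let ι : A →ₐ[ℤ_[5]] PadicAlgCl 5 := (E.val.restrictScalars ℤ_[5]).comp A.val
  have hι (y : A) : ‖ι y‖ ≤ 1 := isIntegral_coe_iff.1 y.2
  let g₁ : A →ₐ[ℤ_[5]] integralClosure ℤ_[5] (PadicAlgCl 5) := ι.codRestrict _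
    fun y ↦ isIntegral_padicInt_iff.2 (hι y)
  let g₂ : A →ₐ[ℤ_[5]] integralClosure ℤ_[5] (PadicAlgCl 5) :=
    (((σ : PadicAlgCl 5 →ₐ[ℚ_[5]] PadicAlgCl 5).restrictScalars ℤ_[5]).comp ι).codRestrict _
      fun y ↦ isIntegral_padicInt_iff.2 ((norm_algEquiv σ (ι y)).trans_le (hι y))
  obtain ⟨ρ, hρ0, hρ1, hρ⟩ := exists_lt_one_forall_le S (f := fun y ↦ ‖σ (ι y) - ι y‖)
    fun y _ ↦ hσ _ (hι y)
  have hle (y : A) : ‖σ (ι y) - ι y‖ ≤ ρ := by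
    have hy : y ∈ Algebra.adjoin ℤ_[5] (S : Set A) := hS ▸ Algebra.mem_top
    induction hy using Algebra.adjoin_induction with
    | mem y hy => exact hρ y hy
    | algebraMap r =>
      rw [AlgHom.commutes, algebraMap_padicInt, AlgEquiv.commutes, sub_self, norm_zero]
      exact hρ0
    | add y z _ _ hy hz =>
      rw [map_add, map_add, add_sub_add_comm]
      exact norm_add_le_of_le' hy hz
    | mul y z _ _ hy hz =>
      rw [map_mul, map_mul, show σ (ι y) * σ (ι z) - ι y * ι z =
        (σ (ι y) - ι y) * σ (ι z) + ι y * (σ (ι z) - ι z) by ring]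
      refine norm_add_le_of_le' ?_ ?_
      · rw [norm_mul, norm_algEquiv]
        exact (mul_le_of_le_one_right (norm_nonneg _) (hι z)).trans hy
      · rw [norm_mul]
        exact (mul_le_of_le_one_left (norm_nonneg _) (hι y)).trans hz
  have hg : g₂ = g₁ := Algebra.FormallyUnramified.ext_of_iInf _ (iInf_normIdeal_pow hρ0 hρ1)
    fun y ↦ by
      rw [Ideal.Quotient.mk_eq_mk_iff_sub_mem, mem_normIdeal]
      exact hle y
  -- a multiple of `x` by a power of `5` is integral
  obtain ⟨N, hN⟩ : ∃ N : ℕ, ‖(5 : PadicAlgCl 5) ^ N * x‖ ≤ 1 := by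
    obtain ⟨N, hN⟩ := pow_unbounded_of_one_lt ‖x‖ (show (1 : ℝ) < 5 by norm_num)
    refine ⟨N, ?_⟩
    rw [norm_mul, norm_pow, norm_five, one_div, inv_pow, inv_mul_le_one₀ (by positivity)]
    exact hN.le
  have h5 : (5 : PadicAlgCl 5) ^ N * x ∈ E := mul_mem (pow_mem (ofNat_mem E 5) N) hx
  let y : A := ⟨⟨_, h5⟩, isIntegral_coe_iff.2 hN⟩
  have hy : σ (5 ^ N * x) = 5 ^ N * x := by
    have := congrArg (fun g ↦ (g y : PadicAlgCl 5)) hg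
    exact this
  rw [map_mul, map_pow, map_ofNat] at hy
  exact mul_left_cancel₀ (pow_ne_zero N (by norm_num)) hy

/-- The residue field of `ℚ̄₅` is algebraic over `𝔽₅`. -/
theorem exists_pow_eq_self (x : integers) : ∃ n, 1 ≤ n ∧ res x ^ 5 ^ n = res x := by
  classical
  have hint : IsIntegral ℚ_[5] (x : PadicAlgCl 5) := Algebra.IsIntegral.isIntegral _
  obtain ⟨g, hg⟩ := exists_map_subtype_eq
    (norm_coeff_minpoly_le (K := ℚ_[5]) (mem_integers.1 x.2))
  obtain ⟨s, hs⟩ : ∃ s : PadicAlgCl 5, s ^ 2 = 5 := IsAlgClosed.exists_pow_nat_eq 5 two_pos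
  have hmon : g.Monic := by
    refine monic_of_injective (f := integers.subtype) Subtype.val_injective ?_
    rw [hg]
    exact (minpoly.monic hint).map _
  have hfrob : (g.map res).map (frobenius ResidueF 5) = g.map res := by
    ext i
    rw [coeff_map, coeff_map]
    refine frobenius_res_of_mem_adjoin hs ?_
    have : (g.coeff i : PadicAlgCl 5) = (g.map integers.subtype).coeff i := by
      rw [coeff_map]
      rfl
    rw [this, hg, coeff_map]
    exact IntermediateField.algebraMap_mem _ _
  have hx : g.eval x = 0 := by
    have h1 := eval₂_at_apply (p := g) integers.subtype x
    rw [← eval_map, hg] at h1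
    refine Subtype.val_injective (h1.symm.trans ?_)
    change eval (x : PadicAlgCl 5) _ = 0
    rw [eval_map_algebraMap, minpoly.aeval]
  have hroot (i : ℕ) : (g.map res).eval ((frobenius ResidueF 5)^[i] (res x)) = 0 := by
    induction i with
    | zero => rw [Function.iterate_zero_apply, eval_map, eval₂_at_apply, hx, map_zero]
    | succ i ih =>
      rw [Function.iterate_succ_apply', ← hfrob, eval_map, eval₂_at_apply, ih, map_zero]
  let f (i : ℕ) : (g.map res).roots.toFinset := ⟨(frobenius ResidueF 5)^[i] (res x), by
    rw [Multiset.mem_toFinset, mem_roots (hmon.map res).ne_zero]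
    exact hroot i⟩
  obtain ⟨i, j, hij, h⟩ := Finite.exists_ne_map_eq_of_infinite f
  wlog hlt : i < j generalizing i j
  · exact this j i hij.symm h.symm (by lia)
  obtain ⟨n, rfl⟩ := Nat.exists_eq_add_of_lt hlt
  refine ⟨n + 1, by lia, ?_⟩
  have h1 : (frobenius ResidueF 5)^[i] (res x) =
      (frobenius ResidueF 5)^[i + (n + 1)] (res x) := congrArg Subtype.val h
  rw [Function.iterate_add_apply] at h1
  have h2 := (frobenius_inj ResidueF 5).iterate i h1
  rw [← isPeriodicPt_frobenius_iff]
  exact h2.symm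

/-! ### The maximal unramified extension does not contain `√5` -/

theorem norm_algEquiv_sub_lt (σ : Gal(PadicAlgCl 5/ℚ_[5])) {x y : PadicAlgCl 5} (hy : σ y = y)
    (hxy : ‖x - y‖ < 1) : ‖σ x - x‖ < 1 := by
  rw [show σ x - x = σ (x - y) - (x - y) by rw [map_sub, hy]; ring]
  exact norm_sub_lt_of_lt (by rwa [norm_algEquiv]) hxy

theorem one_le_norm_sub_two_of_near {x : integers} (hx : res x ≠ 2) {a : PadicAlgCl 5}
    (h : ‖(x : PadicAlgCl 5) - a‖ < 1) : 1 ≤ ‖a - 2‖ := by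
  by_contra! h2
  refine hx (res_eq_two_iff.2 ?_)
  rw [← sub_add_sub_cancel _ a]
  exact norm_add_lt_of_lt h h2

/-- The maximal unramified extension is generated by the periodic points outside the class of `2`:
these represent all other residue classes, so that the automorphisms fixing them are inert. -/
theorem maxUnramified_le_adjoin : maxUnramified ≤ IntermediateField.adjoin ℚ_[5]
    {a : PadicAlgCl 5 | ∃ m, 1 ≤ m ∧ HasPeriod (PadicAlgCl 5) m a ∧ 1 ≤ ‖a - 2‖} := by
  refine sSup_le fun E hE x hx ↦ ?_
  set W := IntermediateField.adjoin ℚ_[5]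
    {a : PadicAlgCl 5 | ∃ m, 1 ≤ m ∧ HasPeriod (PadicAlgCl 5) m a ∧ 1 ≤ ‖a - 2‖} with hW
  rw [← InfiniteGalois.fixedField_fixingSubgroup W, IntermediateField.mem_fixedField_iff]
  intro σ hσ
  rw [IntermediateField.mem_fixingSubgroup_iff] at hσ
  refine IsUnramifiedExt.apply_eq hE (fun y hy ↦ ?_) hx
  lift y to integers using mem_integers.2 hy
  by_cases h2 : res y = 2
  · exact norm_algEquiv_sub_lt σ (map_ofNat σ 2) (res_eq_two_iff.1 h2)
  · obtain ⟨n, hn, hyn⟩ := exists_pow_eq_self y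
    obtain ⟨a, ha, hya⟩ := exists_hasPeriod_near hn y hyn
    exact norm_algEquiv_sub_lt σ (hσ a (IntermediateField.subset_adjoin _ _
      ⟨n, hn, ha, one_le_norm_sub_two_of_near h2 hya⟩)) hya

theorem exists_common_period {T : Finset (PadicAlgCl 5)}
    (hT : ∀ t ∈ T, ∃ m, 1 ≤ m ∧ HasPeriod (PadicAlgCl 5) m t) :
    ∃ N, 2 ≤ N ∧ ∀ t ∈ T, HasPeriod (PadicAlgCl 5) N t := by
  classical
  induction T using Finset.induction with
  | empty => exact ⟨2, le_rfl, by simp⟩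
  | insert a T _ ih =>
    obtain ⟨N, hN, h⟩ := ih fun t ht ↦ hT t (Finset.mem_insert_of_mem ht)
    obtain ⟨m, hm, ha⟩ := hT a (Finset.mem_insert_self a T)
    refine ⟨N * m, hN.trans (Nat.le_mul_of_pos_right N hm), fun t ht ↦ ?_⟩
    rcases Finset.mem_insert.1 ht with rfl | ht
    · exact ha.of_dvd (Dvd.intro_left _ rfl) hm
    · exact (h t ht).of_dvd (Dvd.intro _ rfl) (by lia)

section Sqrt

variable {s : PadicAlgCl 5} (hs : s ^ 2 = 5)
include hs

theorem exists_apply_eq_neg : ∃ τ : Gal(PadicAlgCl 5/ℚ_[5]), τ s = -s := by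
  by_contra! h
  have hfix (τ : Gal(PadicAlgCl 5/ℚ_[5])) : τ s = s := by
    refine (sq_eq_sq_iff_eq_or_eq_neg.1 ?_).resolve_right (h τ)
    rw [← map_pow, hs, map_ofNat]
  obtain ⟨x, hx⟩ := IntermediateField.mem_bot.1 ((InfiniteGalois.mem_bot_iff_fixed s).2 hfix)
  refine norm_ne_norm_mul_sqrt hs (x := x) one_ne_zero ?_
  rw [hx, map_one, one_mul]

/-- Over `ℚ₅(√5)` and over `ℚ₅` a periodic point `b` outside the class of `2` has the same
conjugates, so that `√5 ↦ -√5` extends to an automorphism that fixes `b`. -/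
theorem exists_apply_eq_neg_and_apply_eq {m : ℕ} (hm : 1 ≤ m) {b : PadicAlgCl 5}
    (hb : HasPeriod (PadicAlgCl 5) m b) (hb2 : 1 ≤ ‖b - 2‖) :
    ∃ σ : Gal(PadicAlgCl 5/ℚ_[5]), σ s = -s ∧ σ b = b := by
  obtain ⟨τ, hτ⟩ := exists_apply_eq_neg hs
  lift b to integers using mem_integers.2 (hb.norm_le_one hm)
  have hmin := (minpoly_eq_and_natDegree hs hm hb fun h ↦ not_lt.2 hb2 (res_eq_two_iff.1 h)).1
  have hroot : aeval (τ b)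
      (minpoly (IntermediateField.adjoin ℚ_[5] {s}) (b : PadicAlgCl 5)) = 0 := by
    rw [hmin, aeval_map_algebraMap, aeval_algHom_apply, minpoly.aeval, map_zero]
  have : Normal (IntermediateField.adjoin ℚ_[5] {s}) (PadicAlgCl 5) :=
    Normal.tower_top_of_normal ℚ_[5] _ _
  obtain ⟨φ, hφ⟩ := exists_conj_of_aeval_minpoly hroot
  have hφs : φ s = s :=
    φ.commutes ⟨s, IntermediateField.mem_adjoin_simple_self ℚ_[5] s⟩
  refine ⟨τ.trans (φ.restrictScalars ℚ_[5]).symm, ?_, ?_⟩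
  · rw [AlgEquiv.trans_apply, hτ, AlgEquiv.symm_apply_eq]
    change -s = φ (-s)
    rw [map_neg, hφs]
  · rw [AlgEquiv.trans_apply, AlgEquiv.symm_apply_eq]
    exact hφ.symm

/-- Otherwise `s` would lie in the field generated by finitely many periodic points outside the
class of `2`. All of them are fixed by an automorphism that fixes one such point `b` whose residue class
generates a field containing their residue classes; but it can be chosen to move `s`. -/
theorem sqrt_notMem_maxUnramified : s ∉ maxUnramified := by
  intro h
  obtain ⟨T, hT, hsT⟩ := IntermediateField.exists_finset_of_mem_adjoin (maxUnramified_le_adjoin h)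
  obtain ⟨N, hN, hper⟩ := exists_common_period fun t ht ↦ (hT ht).imp fun m hm ↦ ⟨hm.1, hm.2.1⟩
  have h25 : 5 ^ 2 ≤ 5 ^ N := Nat.pow_le_pow_right (by norm_num) hN
  -- a periodic point `b` whose residue class generates the field of `5 ^ N` elements
  have hne : NeZero ((5 ^ N - 1 : ℕ) : ResidueF) := ⟨by
    rw [Nat.cast_sub (by lia), Nat.cast_pow, Nat.cast_ofNat, CharP.ofNat_eq_zero ResidueF 5,
      zero_pow (by lia), zero_sub, Nat.cast_one]
    exact neg_ne_zero.2 one_ne_zero⟩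
  have hne' : NeZero (5 ^ N - 1) := ⟨by lia⟩
  obtain ⟨ζ, hζ⟩ := HasEnoughRootsOfUnity.exists_primitiveRoot ResidueF (5 ^ N - 1)
  obtain ⟨z, rfl⟩ := res_surjective ζ
  have hz2 : res z ≠ 2 := fun h2 ↦ by
    have h16 : (2 : ResidueF) ^ 4 = 1 := by
      have := CharP.ofNat_eq_zero ResidueF 5
      linear_combination 3 * this
    have := Nat.le_of_dvd (by norm_num) (hζ.dvd_of_pow_eq_one 4 (by rw [h2, h16]))
    lia
  obtain ⟨b, hb, hzb⟩ := exists_hasPeriod_near (n := N) (by lia) z (by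
    rw [← Nat.sub_add_cancel (show 1 ≤ 5 ^ N by lia), pow_succ, hζ.pow_eq_one, one_mul])
  have hb2 := one_le_norm_sub_two_of_near hz2 hzb
  obtain ⟨σ, hσs, hσb⟩ := exists_apply_eq_neg_and_apply_eq hs (by lia) hb hb2
  -- the residue class of `t ∈ T` is zero or a power of that of `b`
  have hfix : ∀ t ∈ T, σ t = t := by
    intro t ht
    obtain ⟨-, -, -, ht2⟩ := hT ht
    have hpt := hper t ht
    refine (HasPeriod.eq_of_norm_sub_lt (by lia) hpt (hpt.map σ) ht2 ?_).symm
    rw [norm_sub_rev]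
    lift t to integers using mem_integers.2 (hpt.norm_le_one (by lia))
    lift b to integers using mem_integers.2 (hb.norm_le_one (by lia))
    rw [← res_eq_iff] at hzb
    have hpow : res t ^ 5 ^ N = res t := by
      rw [← map_pow, res_eq_iff]
      exact hpt.norm_pow_sub_lt norm_five (by lia) ht2
    by_cases h0 : res t = 0
    · refine norm_algEquiv_sub_lt σ (map_zero σ) ?_
      rw [sub_zero]
      exact res_eq_zero_iff.1 h0
    · have h1 : res t ^ (5 ^ N - 1) = 1 := by
        refine mul_right_cancel₀ h0 ?_
        rw [← pow_succ, Nat.sub_add_cancel (by lia), hpow, one_mul]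
      obtain ⟨j, -, hj⟩ := hζ.eq_pow_of_pow_eq_one h1
      rw [hzb, ← map_pow, eq_comm, res_eq_iff] at hj
      exact norm_algEquiv_sub_lt σ (y := (b : PadicAlgCl 5) ^ j) (by rw [map_pow, hσb]) hj
  have hss : σ s = s := by
    refine IntermediateField.adjoin_induction ℚ_[5] (p := fun x _ ↦ σ x = x) hfix
      (fun x ↦ σ.commutes x) ?_ ?_ ?_ hsT
    · intro x y _ _ hx hy
      rw [map_add, hx, hy]
    · intro x _ hx
      rw [map_inv₀, hx]
    · intro x y _ _ hx hy
      rw [map_mul, hx, hy]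
  have h2s : 2 * s = 0 := by linear_combination hσs - hss
  have hs0 : s = 0 := (mul_eq_zero.1 h2s).resolve_left two_ne_zero
  rw [hs0] at hs
  norm_num at hs

/-! ### The two halves of the periodic points -/

omit hs in
theorem hasPeriod_one_of_sq {A : Type*} [CommRing A] {a : A} (ha : a ^ 2 = -1) :
    HasPeriod A 1 a := by
  refine ⟨fun _ ↦ a, rfl, rfl, fun _ _ ↦ ?_⟩
  unfold gPoly
  linear_combination
    (a ^ 7 + 2 * a ^ 6 + 3 * a ^ 5 + a ^ 4 - 3 * a ^ 3 + 2 * a ^ 2 - a) * ha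

/-- With `b = A(a)`, the defining equation reads `s (a + b) = 2 - a - b - 2 a b`. -/
theorem fricke_notMem_maxUnramified {a : PadicAlgCl 5} (ha : a ∈ maxUnramified) (ha1 : a ^ 2 ≠ -1)
    (hp : a ≠ frickePole s) : fricke s a ∉ maxUnramified := by
  intro hb
  have h := fricke_mul_denom hp
  set b := fricke s a with hbdef
  have hab : a + b ≠ 0 := fun h0 ↦ ha1 (by linear_combination (-(1/2)) * h + (a + (1 + s)/2) * h0)
  have hse : s = (2 - a - b - 2 * a * b) / (a + b) := by
    rw [eq_div_iff hab]
    linear_combination h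
  refine sqrt_notMem_maxUnramified hs ?_
  rw [hse]
  have h2 : (2 : PadicAlgCl 5) ∈ maxUnramified := ofNat_mem _ 2
  exact div_mem (sub_mem (sub_mem (sub_mem h2 ha) hb) (mul_mem (mul_mem h2 ha) hb)) (add_mem ha hb)


theorem hasMinimalPeriod_fricke_iff {a : PadicAlgCl 5} (he : a ≠ frickePole s) (n : ℕ) :
    HasMinimalPeriod (PadicAlgCl 5) n (fricke s a) ↔ HasMinimalPeriod (PadicAlgCl 5) n a := by
  unfold HasMinimalPeriod
  simp only [hasPeriod_fricke_iff hs he]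

theorem HasMinimalPeriod.eq_one {n : ℕ} (h : HasMinimalPeriod (PadicAlgCl 5) n (frickePole s)) :
    n = 1 :=
  le_antisymm (h.2 ⟨le_rfl, hasPeriod_frickePole hs 1⟩) h.1.1

omit hs in
theorem frickePole_mem (K : IntermediateField ℚ_[5] (PadicAlgCl 5)) (h : s ∈ K) :
    frickePole s ∈ K :=
  div_mem (neg_mem (add_mem (one_mem K) h)) (ofNat_mem K 2)

omit hs in
theorem fricke_mem {K L : Type*} [Field L] [SetLike K L] [SubfieldClass K L] {k : K} {s a : L}
    (hs : s ∈ k) (ha : a ∈ k) : fricke s a ∈ k := by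
  have h2 : (2 : L) ∈ k := ofNat_mem k 2
  have h1 : (1 : L) ∈ k := one_mem k
  exact div_mem (add_mem (mul_mem (neg_mem (add_mem h1 hs)) ha) h2)
    (add_mem (add_mem (mul_mem h2 ha) h1) hs)

/-- Every periodic point is the pole of the Fricke involution, or lies outside the class of `2`,
or is the image under the Fricke involution of a periodic point that does. -/
theorem periodic_cases {n : ℕ} (hn : 1 ≤ n) {a : PadicAlgCl 5}
    (ha : HasPeriod (PadicAlgCl 5) n a) : a = frickePole s ∨ 1 ≤ ‖a - 2‖ ∨
      a ≠ frickePole s ∧ 1 ≤ ‖fricke s a - 2‖ := by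
  by_cases he : a = frickePole s
  · exact Or.inl he
  rcases le_or_gt 1 ‖a - 2‖ with h | h
  · exact Or.inr (Or.inl h)
  · exact Or.inr (Or.inr ⟨he, ha.one_le_norm_fricke_sub_two norm_five hs hn h he⟩)

theorem mem_sup_of_hasPeriod {n : ℕ} (hn : 1 ≤ n) {a : PadicAlgCl 5}
    (ha : HasPeriod (PadicAlgCl 5) n a) :
    a ∈ maxUnramified ⊔ IntermediateField.adjoin ℚ_[5] {s} := by
  have hsmem : s ∈ maxUnramified ⊔ IntermediateField.adjoin ℚ_[5] {s} :=
    le_sup_right (a := maxUnramified) (IntermediateField.mem_adjoin_simple_self ℚ_[5] s)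
  have hle : maxUnramified ≤ maxUnramified ⊔ IntermediateField.adjoin ℚ_[5] {s} := le_sup_left
  rcases periodic_cases hs hn ha with rfl | h | ⟨he, h⟩
  · exact frickePole_mem _ hsmem
  · exact hle (mem_maxUnramified_of_hasPeriod hs hn ha h)
  · rw [← fricke_fricke hs he]
    exact fricke_mem hsmem (hle (mem_maxUnramified_of_hasPeriod hs hn (ha.map_fricke hs he) h))

/-! ### Degrees over `ℚ₅(√5)` -/

theorem natDegree_minpoly_of_one_le {n : ℕ} {a : PadicAlgCl 5}
    (ha : HasMinimalPeriod (PadicAlgCl 5) n a) (ha2 : 1 ≤ ‖a - 2‖) :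
    (minpoly (IntermediateField.adjoin ℚ_[5] {s}) a).natDegree = n := by
  have hn := ha.1.1
  lift a to integers using mem_integers.2 (ha.1.2.norm_le_one hn)
  have ha2' : res a ≠ 2 := fun h ↦ not_lt.2 ha2 (res_eq_two_iff.1 h)
  obtain ⟨h1, h2⟩ := minpoly_eq_and_natDegree hs hn ha.1.2 ha2'
  rw [h1, natDegree_map, h2]
  have hpos := minimalPeriod_pos_of_hasPeriod hn ha.1.2 ha2'
  exact Nat.dvd_antisymm ((hasPeriod_iff_minimalPeriod_dvd hn hn ha.1.2 ha2').1 ha.1.2)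
    ((ha.hasPeriod_iff hs hpos).1
      ((hasPeriod_iff_minimalPeriod_dvd hn hpos ha.1.2 ha2').2 dvd_rfl))

theorem natDegree_minpoly_fricke {a : PadicAlgCl 5} (he : a ≠ frickePole s) :
    (minpoly (IntermediateField.adjoin ℚ_[5] {s}) (fricke s a)).natDegree =
      (minpoly (IntermediateField.adjoin ℚ_[5] {s}) a).natDegree := by
  have hint (x : PadicAlgCl 5) : IsIntegral (IntermediateField.adjoin ℚ_[5] {s}) x :=
    (Algebra.IsIntegral.isIntegral (R := ℚ_[5]) x).tower_top
  have hsmem (k : IntermediateField (IntermediateField.adjoin ℚ_[5] {s}) (PadicAlgCl 5)) :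
      s ∈ k :=
    k.algebraMap_mem ⟨s, IntermediateField.mem_adjoin_simple_self ℚ_[5] s⟩
  rw [← IntermediateField.adjoin.finrank (hint _), ← IntermediateField.adjoin.finrank (hint _)]
  suffices h : IntermediateField.adjoin (IntermediateField.adjoin ℚ_[5] {s}) {fricke s a} =
      IntermediateField.adjoin (IntermediateField.adjoin ℚ_[5] {s}) {a} by rw [h]
  refine le_antisymm (IntermediateField.adjoin_simple_le_iff.2 ?_)
    (IntermediateField.adjoin_simple_le_iff.2 ?_)
  · exact fricke_mem (hsmem _) (IntermediateField.mem_adjoin_simple_self _ a)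
  · have h := fricke_mem (hsmem _) (IntermediateField.mem_adjoin_simple_self
      (IntermediateField.adjoin ℚ_[5] {s}) (fricke s a))
    rwa [fricke_fricke hs he] at h

theorem natDegree_minpoly {n : ℕ} {a : PadicAlgCl 5}
    (ha : HasMinimalPeriod (PadicAlgCl 5) n a) :
    (minpoly (IntermediateField.adjoin ℚ_[5] {s}) a).natDegree = n := by
  rcases periodic_cases hs ha.1.1 ha.1.2 with rfl | h | ⟨he, h⟩
  · rw [ha.eq_one hs, minpoly.natDegree_eq_one_iff]
    exact ⟨⟨_, frickePole_mem _ (IntermediateField.mem_adjoin_simple_self ℚ_[5] s)⟩, rfl⟩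
  · exact natDegree_minpoly_of_one_le hs ha h
  · rw [← natDegree_minpoly_fricke hs he]
    exact natDegree_minpoly_of_one_le hs ((hasMinimalPeriod_fricke_iff hs he n).2 ha) h

/-! ### Counting the points in the maximal unramified extension -/

omit hs in
theorem finite_hasMinimalPeriod (n : ℕ) :
    {a : PadicAlgCl 5 | HasMinimalPeriod (PadicAlgCl 5) n a}.Finite := by
  classical
  refine ((Rdiag n).aroots (PadicAlgCl 5)).toFinset.finite_toSet.subset fun a ha ↦ ?_
  exact Multiset.mem_toFinset.2 ((mem_aroots_Rdiag ha.1.1).2 ha.1.2)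

theorem mem_maxUnramified_iff {n : ℕ} (hn : 1 < n) {a : PadicAlgCl 5}
    (ha : HasMinimalPeriod (PadicAlgCl 5) n a) : a ∈ maxUnramified ↔ 1 ≤ ‖a - 2‖ := by
  refine ⟨fun h ↦ ?_, mem_maxUnramified_of_hasPeriod hs ha.1.1 ha.1.2⟩
  rcases periodic_cases hs ha.1.1 ha.1.2 with rfl | h1 | ⟨he, h1⟩
  · exact absurd (ha.eq_one hs) hn.ne'
  · exact h1
  · refine absurd (mem_maxUnramified_of_hasPeriod hs ha.1.1 (ha.1.2.map_fricke hs he) h1)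
      (fricke_notMem_maxUnramified hs h (fun hsq ↦ ?_) he)
    exact not_le.2 hn (ha.2 ⟨le_rfl, hasPeriod_one_of_sq hsq⟩)

theorem two_mul_ncard {n : ℕ} (hn : 1 < n) :
    2 * {a : PadicAlgCl 5 | HasMinimalPeriod (PadicAlgCl 5) n a ∧ a ∈ maxUnramified}.ncard =
      {a : PadicAlgCl 5 | HasMinimalPeriod (PadicAlgCl 5) n a}.ncard := by
  set S := {a : PadicAlgCl 5 | HasMinimalPeriod (PadicAlgCl 5) n a} with hS
  have hfin : S.Finite := finite_hasMinimalPeriod n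
  set T := {a : PadicAlgCl 5 | HasMinimalPeriod (PadicAlgCl 5) n a ∧ a ∈ maxUnramified} with hT
  have hTS : T ⊆ S := fun a ha ↦ ha.1
  have hmem {a : PadicAlgCl 5} (ha : a ∈ T) : 1 ≤ ‖a - 2‖ :=
    (mem_maxUnramified_iff hs hn ha.1).1 ha.2
  have hpole {a : PadicAlgCl 5} (ha : a ∈ S) : a ≠ frickePole s := by
    rintro rfl
    exact hn.ne' (HasMinimalPeriod.eq_one hs ha)
  have hdisj : Disjoint T (fricke s '' T) := by
    rw [Set.disjoint_left]
    rintro _ hb ⟨a, ha, rfl⟩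
    exact not_lt.2 (hmem hb) (norm_fricke_sub_two_lt norm_five hs (hpole (hTS ha))
      (ha.1.1.2.norm_le_one ha.1.1.1) (hmem ha))
  have hunion : S = T ∪ fricke s '' T := by
    ext a
    constructor
    · intro ha
      rcases periodic_cases hs ha.1.1 ha.1.2 with h | h | ⟨he, h⟩
      · exact absurd h (hpole ha)
      · exact Or.inl ⟨ha, (mem_maxUnramified_iff hs hn ha).2 h⟩
      · have hf := (hasMinimalPeriod_fricke_iff hs he n).2 ha
        exact Or.inr ⟨fricke s a, ⟨hf, (mem_maxUnramified_iff hs hn hf).2 h⟩,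
          fricke_fricke hs he⟩
    · rintro (ha | ⟨b, hb, rfl⟩)
      · exact hTS ha
      · exact (hasMinimalPeriod_fricke_iff hs (hpole (hTS hb)) n).2 hb.1
  have hinj : Set.InjOn (fricke s) T := fun a ha b hb hab ↦ by
    rw [← fricke_fricke hs (hpole (hTS ha)), hab, fricke_fricke hs (hpole (hTS hb))]
  have hTfin := hfin.subset hTS
  rw [hunion, Set.ncard_union_eq hdisj hTfin (hTfin.image _), hinj.ncard_image, two_mul]

end Sqrt

theorem theorem2p1 (s : PadicAlgCl 5) (hs : s ^ 2 = 5) :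
    (∀ a : PadicAlgCl 5, IsPeriodicPoint (PadicAlgCl 5) a →
      a ∈ maxUnramified ⊔ IntermediateField.adjoin ℚ_[5] {s}) ∧
    ∀ n : ℕ, 1 ≤ n →
      (∃ P : ℤ[X],
        algebraMap ℤ[X] (FractionRing ℤ[X]) P = Pfrac n ∧
        (P.aroots (PadicAlgCl 5)).Nodup ∧
        (n = 1 → P.natDegree = 9) ∧
        (1 < n → (P.natDegree : ℤ) =
          2 * ∑ k ∈ n.divisors, ArithmeticFunction.moebius (n / k) * 5 ^ k) ∧
        (∀ a : PadicAlgCl 5, HasMinimalPeriod (PadicAlgCl 5) n a ↔ aeval a P = 0)) ∧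
      (∀ a : PadicAlgCl 5, HasMinimalPeriod (PadicAlgCl 5) n a →
        (minpoly (IntermediateField.adjoin ℚ_[5] {s}) a).natDegree = n) ∧
      (1 < n →
        {a : PadicAlgCl 5 | HasMinimalPeriod (PadicAlgCl 5) n a}.Finite ∧
        2 * {a : PadicAlgCl 5 | HasMinimalPeriod (PadicAlgCl 5) n a ∧ a ∈ maxUnramified}.ncard =
          {a : PadicAlgCl 5 | HasMinimalPeriod (PadicAlgCl 5) n a}.ncard) := by
  refine ⟨fun a ⟨n, hn, ha⟩ ↦ mem_sup_of_hasPeriod hs hn ha, fun n hn ↦ ⟨⟨dynatomic n,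
    algebraMap_dynatomic hs hn, nodup_aroots_dynatomic hs hn, ?_, ?_,
    fun a ↦ ((dynatomic_spec hs hn).2 a).symm⟩, fun a ha ↦ natDegree_minpoly hs ha,
    fun h ↦ ⟨finite_hasMinimalPeriod n, two_mul_ncard hs h⟩⟩⟩
  · rintro rfl
    exact natDegree_dynatomic_one hs
  · intro h
    exact natDegree_dynatomic_of_one_lt hs h
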